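/- Let $\Phi$ be the standard normal distribution function. A randomized algorithm at size $(M,N)$ is a measurable map $\mathcal A:\mathbb R^{M\times N}\times\Omega\to\{\pm1\}^N$, where $(\Omega,\mathbb P_\omega)$ is an arbitrary probability space carrying the internal randomness $\omega$, independent of the data; no bound on its running time is imposed. For $\kappa,\rho,p_f,p_{\mathrm{st}},f,L\in\mathbb R$ with $|\rho|\le 1$, $\mathcal A$ is called $(\rho,p_f,p_{\mathrm{st}},f,L)$-stable at size $(M,N)$ for the binary perceptron with margin $\kappa$ if * (Success) for $X\in\mathbb R^{M\times N}$ with i.i.d. ${\sf N}(0,1)$ entries, $\mathbb P_{(X,\omega)}[X\mathcal A(X,\omega)\ge\kappa\sqrt N\text{ entrywise}]\ge 1-p_f$; * (Stability) for $X,\overline X\in\mathbb R^{M\times N}$ whose entry pairs $(X_{ij},\overline X_{ij})$ are i.i.d. centered bivariate Gaussian with unit variances and covariance $\rho$, $\mathbb P_{(X,\overline X,\omega)}[d_H(\mathcal A(X,\omega),\mathcal A(\overline X,\omega))\le f+L\|X-\overline X\|_F]\ge 1-p_{\mathrm{st}}$, where $d_H$ is the Hamming distance and $\|\cdot\|_F$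 the Frobenius norm. Given a sequence $M=M_N$, a sequence of randomized algorithms $\mathcal A_N:\mathbb R^{M_N\times N}\times\Omega\to\{\pm1\}^N$ is called $(\rho,p_f,p_{\mathrm{st}},f,L)$-stable (with $f=f(N)$) if $\mathcal A_N$ is $(\rho,p_f,p_{\mathrm{st}},f(N),L)$-stable at size $(M_N,N)$ for all sufficiently large $N$. **Theorem.** There exist constants $C_1>0$, $\kappa_1<0$ and $N_0\in\mathbb N$ such that for all $\kappa<\kappa_1$, all $\alpha>\dfrac{C_1\log^2|\kappa|}{\kappa^2\,\Phi(\kappa)}$ and all $L>0$ there exist constants $\rho,p_f,p_{\mathrm{st}}\in(0,1)$ and $C>0$ (depending only on $\kappa,\alpha,L$) such that the following hold. 1. For every sequence $(M_N)$ of natural numbers with $M_N/N\to\alpha$, there is no randomized algorithm (sequence $\mathcal A_N$ as above) that is $(\rho,p_f,p_{\mathrm{st}},CN,L)$-stable for the binary perceptron with margin $\kappa$. 2. There is $\delta>0$ such that for every $N>N_0$ and every $M\in\mathbb N$ with $|M/N-\alpha|\le\delta$, there is no randomized algorithm $\mathcal A:\mathbb R^{M\times N}\times\Omega\to\{\pm1\}^N$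 that is $(\rho,p_f,p_{\mathrm{st}},CN,L)$-stable at size $(M,N)$ for the binary perceptron with margin $\kappa$. -/

import Mathlib

open MeasureTheory ProbabilityTheory Filter Topology

noncomputable section

namespace BinaryPerceptron

/-- Real `M × N` matrices. A type of functions, so that it carries the product sigma-algebra. -/
abbrev DataMatrix (M N : ℕ) : Type := Fin M → Fin N → ℝ

/-- The law of an `M × N` matrix with i.i.d. standard Gaussian entries. -/
def gaussianMatrix (M N : ℕ) : Measure (DataMatrix M N) :=
  Measure.pi fun _ : Fin M => Measure.pi fun _ : Fin N => gaussianReal 0 1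

/-- For `ρ ∈ [-1, 1]`, the law of a pair `(X, Y)` of `M × N` matrices whose entry pairs
`(X i j, Y i j)` are i.i.d. centered bivariate Gaussian with unit variances and covariance `ρ`,
realized as `Y = ρ X + √(1 - ρ²) Z` with `Z` an independent copy of `X`. -/
def correlatedGaussianMatrices (M N : ℕ) (ρ : ℝ) :
    Measure (DataMatrix M N × DataMatrix M N) :=
  ((gaussianMatrix M N).prod (gaussianMatrix M N)).map
    fun p => (p.1, ρ • p.1 + √(1 - ρ ^ 2) • p.2)

/-- `X θ ≥ κ √N` entrywise, for a sign vector `θ ∈ {±1}^N`; signs are units of `ℤ`. -/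
def IsSolution {M N : ℕ} (κ : ℝ) (X : DataMatrix M N) (θ : Fin N → ℤˣ) : Prop :=
  ∀ i, κ * √(N : ℝ) ≤ ∑ j, X i j * ((θ j : ℤ) : ℝ)

/-- The Frobenius norm of a real matrix. -/
def frobNorm {M N : ℕ} (X : DataMatrix M N) : ℝ :=
  √(∑ i, ∑ j, X i j ^ 2)

/-- The stability conditions at a fixed size `(M, N)` for a randomized algorithm
`A : ℝ^{M × N} × Ω → {±1}^N` with internal randomness `ω ∼ P`; here `f` is a number. -/
structure IsStableAt {Ω : Type*} [MeasurableSpace Ω] (P : Measure Ω) {M N : ℕ}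
    (κ ρ pf pst f L : ℝ) (A : DataMatrix M N → Ω → (Fin N → ℤˣ)) : Prop where
  measurable : Measurable (Function.uncurry A)
  success : 1 - pf ≤ ((gaussianMatrix M N).prod P).real {q | IsSolution κ q.1 (A q.1 q.2)}
  stability : 1 - pst ≤ ((correlatedGaussianMatrices M N ρ).prod P).real
    {q | (hammingDist (A q.1.1 q.2) (A q.1.2 q.2) : ℝ) ≤ f + L * frobNorm (q.1.1 - q.1.2)}

/-- A randomized algorithm (one map for every `N`, on matrices with `M N` rows) is
`(ρ, pf, pst, f, L)`-stable if the success and stability conditions hold for all sufficiently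
large `N`. -/
def IsStable {Ω : Type*} [MeasurableSpace Ω] (P : Measure Ω) (M : ℕ → ℕ)
    (κ ρ pf pst : ℝ) (f : ℕ → ℝ) (L : ℝ)
    (A : ∀ N, DataMatrix (M N) N → Ω → (Fin N → ℤˣ)) : Prop :=
  ∀ᶠ N in atTop, IsStableAt P κ ρ pf pst (f N) L (A N)

end BinaryPerceptron

end

open BinaryPerceptron

noncomputable section

open scoped NNReal ENNReal

namespace BinaryPerceptron

/-! This is an overlap-gap argument with ladders of solutions. Run a stable algorithm, with one
fixed `ω`, along a stationary Gaussian chain of matrices `X_0, …, X_T` with lag-one correlation `ρ`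
close to 1. As `T` does not grow with `N`, constant `pf` and `pst` suffice for a union bound: with
positive probability all outputs are solutions and every move is at most `βN`. From such a slow path
`exists_ladder` extracts greedily `m = n + 1` outputs, any two at Hamming distance at least `βN` or
at least `K` time steps apart, each after the first within `2βN` of an earlier one.

A first moment excludes such ladders. Closeness bounds their number by `2^N (m exp(N h))^n` with `h
= 2β(1 - log 2β)` (`card_hammingBall_le`, `card_isLinked_le`). Separation makes the events that the
vectors violate a given row almost disjoint: a joint violation pushes a Gaussian of variance at most
`4N(1-β)` below `2κ√N`, which costs a factor `2exp(-βκ²/2)` beyond `Φ(κ)`. By Bonferroni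
(`rowNoise_real_le`) all `m` vectors satisfy a row with probability at most `exp(-mΦ(κ)/2)`. For `β`
of order `log|κ|/κ²` and `m ≈ κ²` the entropy per vector is of order `log²|κ|/κ²`, and about `αN`
rows beat it once `αΦ(κ)` exceeds a multiple of that (`ladder_estimates`).

This handles `N` beyond some `N₁`. For the finitely many smaller sizes `pf` is put below the
positive probability that no solution exists (`exists_lt_no_solution_prob`), so `N₀ = 0` works. -/

/-! ### Sums of independent Gaussians and product laws -/

lemma map_finsetSum_gaussianReal {Ω ι : Type*} {mΩ : MeasurableSpace Ω} {P : Measure Ω}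
    [IsProbabilityMeasure P] {X : ι → Ω → ℝ} {v : ι → ℝ≥0} (hX : ∀ i, Measurable (X i))
    (hlaw : ∀ i, P.map (X i) = gaussianReal 0 (v i)) (hind : iIndepFun X P) (s : Finset ι) :
    P.map (∑ i ∈ s, X i) = gaussianReal 0 (∑ i ∈ s, v i) := by
  classical
  induction s using Finset.induction_on with
  | empty =>
    simp only [Finset.sum_empty, gaussianReal_zero_var]
    have : (0 : Ω → ℝ) = fun _ => (0 : ℝ) := rfl
    rw [this, Measure.map_const]; simp
  | insert a s ha ih =>
    rw [Finset.sum_insert ha, Finset.sum_insert ha]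
    have h := gaussianReal_add_gaussianReal_of_indepFun
      (hind.indepFun_finsetSum_of_notMem hX ha).symm (hlaw a) ih
    simpa using h

lemma map_sum_pi_gaussianReal {ι : Type*} [Fintype ι] {E : ι → Type*}
    [∀ i, MeasurableSpace (E i)] {μ : ∀ i, Measure (E i)} [∀ i, IsProbabilityMeasure (μ i)]
    {f : ∀ i, E i → ℝ} {v : ι → ℝ≥0} (hf : ∀ i, Measurable (f i))
    (hlaw : ∀ i, (μ i).map (f i) = gaussianReal 0 (v i)) :
    (Measure.pi μ).map (fun z => ∑ i, f i (z i)) = gaussianReal 0 (∑ i, v i) := by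
  classical
  have h := map_finsetSum_gaussianReal (P := Measure.pi μ) (X := fun i z => f i (z i)) (v := v)
    (fun i => (hf i).comp (measurable_pi_apply i)) (fun i => ?_)
    (iIndepFun_pi (fun i => (hf i).aemeasurable)) Finset.univ
  · convert h using 2
    ext z
    simp
  · have : (fun z : ∀ i, E i => f i (z i)) = f i ∘ Function.eval i := rfl
    rw [this, ← Measure.map_map (hf i) (measurable_pi_apply i), Measure.pi_map_eval]
    simp [hlaw i]

/-- The coordinatewise image of a product measure under a map to pairs whose law is a product. -/
lemma map_pi_prod {ι E F G : Type*} [Fintype ι] [MeasurableSpace E] [MeasurableSpace F]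
    [MeasurableSpace G] {μ : Measure E} [IsProbabilityMeasure μ] {f : E → F} {g : E → G}
    {ν : Measure F} {ξ : Measure G} [IsProbabilityMeasure ν] [IsProbabilityMeasure ξ]
    (hf : Measurable f) (hg : Measurable g) (h : μ.map (fun z => (f z, g z)) = ν.prod ξ) :
    (Measure.pi fun _ : ι => μ).map (fun z => ((fun i => f (z i)), fun i => g (z i))) =
      (Measure.pi fun _ : ι => ν).prod (Measure.pi fun _ : ι => ξ) := by
  have hind : IndepFun f g μ := by
    rw [indepFun_iff_map_prod_eq_prod_map_map hf.aemeasurable hg.aemeasurable, h]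
    have h1 : μ.map f = ν := by
      have : f = Prod.fst ∘ fun z => (f z, g z) := rfl
      rw [this, ← Measure.map_map measurable_fst (hf.prodMk hg), h]
      simp
    have h2 : μ.map g = ξ := by
      have : g = Prod.snd ∘ fun z => (f z, g z) := rfl
      rw [this, ← Measure.map_map measurable_snd (hf.prodMk hg), h]
      simp
    rw [h1, h2]
  refine (Measure.prod_eq_generateFrom
    (C := Set.pi Set.univ '' Set.pi Set.univ fun _ : ι => {s : Set F | MeasurableSet s})
    (D := Set.pi Set.univ '' Set.pi Set.univ fun _ : ι => {s : Set G | MeasurableSet s})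
    generateFrom_pi generateFrom_pi isPiSystem_pi isPiSystem_pi ?_ ?_ ?_).symm
  · exact ⟨fun _ => Set.univ, fun _ => ⟨fun _ => Set.univ, by simp, by simp⟩,
      fun _ => by simp, by simp [Set.iUnion_const]⟩
  · exact ⟨fun _ => Set.univ, fun _ => ⟨fun _ => Set.univ, by simp, by simp⟩,
      fun _ => by simp, by simp [Set.iUnion_const]⟩
  · rintro _ ⟨s, hs, rfl⟩ _ ⟨t, ht, rfl⟩
    have hs' : ∀ i, MeasurableSet (s i) := fun i => hs i trivial
    have ht' : ∀ i, MeasurableSet (t i) := fun i => ht i trivial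
    rw [Measure.map_apply (by fun_prop)
      ((MeasurableSet.univ_pi hs').prod (MeasurableSet.univ_pi ht'))]
    have : (fun z : ι → E => ((fun i => f (z i)), fun i => g (z i))) ⁻¹'
        (Set.univ.pi s ×ˢ Set.univ.pi t) =
        Set.univ.pi fun i => (fun z => (f z, g z)) ⁻¹' (s i ×ˢ t i) := by
      ext z
      simp [Set.mem_pi, forall_and]
    rw [this, Measure.pi_pi, Measure.pi_pi, Measure.pi_pi, ← Finset.prod_mul_distrib]
    refine Finset.prod_congr rfl fun i _ => ?_
    rw [← Measure.map_apply (hf.prodMk hg) ((hs' i).prod (ht' i)), h, Measure.prod_prod]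

/-! ### The scalar autoregressive chain -/

/-- The law of an i.i.d. sequence of standard Gaussians. -/
def noise : Measure (ℕ → ℝ) := Measure.infinitePi fun _ => gaussianReal 0 1

instance : IsProbabilityMeasure noise := by unfold noise; infer_instance

/-- The autoregressive chain driven by the noise `z`: under `noise` it is a stationary Gaussian
Markov chain with lag-one correlation `ρ`. -/
def arChain (ρ : ℝ) : ℕ → (ℕ → ℝ) → ℝ
  | 0, z => z 0
  | n + 1, z => ρ * arChain ρ n z + √(1 - ρ ^ 2) * z (n + 1)

@[fun_prop]
lemma measurable_arChain (ρ : ℝ) (n : ℕ) : Measurable (arChain ρ n) := by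
  induction n with
  | zero => exact measurable_pi_apply 0
  | succ n ih =>
    exact (ih.const_mul ρ).add ((measurable_pi_apply (n + 1)).const_mul _)

lemma arChain_congr (ρ : ℝ) (n : ℕ) {z w : ℕ → ℝ} (h : ∀ s ≤ n, z s = w s) :
    arChain ρ n z = arChain ρ n w := by
  induction n with
  | zero => exact h 0 le_rfl
  | succ n ih =>
    simp only [arChain]
    rw [ih fun s hs => h s (hs.trans n.le_succ), h _ le_rfl]

lemma map_noise_eval (n : ℕ) : noise.map (fun z => z n) = gaussianReal 0 1 := by
  unfold noise
  exact Measure.infinitePi_map_eval (μ := fun _ : ℕ => gaussianReal 0 1) n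

lemma iIndepFun_noise : iIndepFun (fun (n : ℕ) (z : ℕ → ℝ) => z n) noise :=
  iIndepFun_infinitePi (P := fun _ : ℕ => gaussianReal 0 1) (X := fun _ x => x)
    (fun _ => measurable_id)

/-- The chain up to time `n` reads only the noise coordinates `0, …, n`, which are independent of
coordinate `n + 1`. -/
lemma indepFun_arChain_noise (ρ : ℝ) {t n : ℕ} (h : t ≤ n) :
    IndepFun (fun z => (arChain ρ t z, arChain ρ n z)) (fun z => z (n + 1)) noise := by
  have h0 := iIndepFun_noise.indepFun_finset (Finset.range (n + 1)) {n + 1} (by simp)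
    (fun i => measurable_pi_apply i)
  -- Padding by zeros lets `arChain`, defined on infinite sequences, be evaluated on the finite
  -- block.
  let ext : (Finset.range (n + 1) → ℝ) → ℕ → ℝ :=
    fun y s => if hs : s ∈ Finset.range (n + 1) then y ⟨s, hs⟩ else 0
  have hext : Measurable ext := by
    refine measurable_pi_lambda _ fun s => ?_
    by_cases hs : s ∈ Finset.range (n + 1)
    · simp only [ext, dif_pos hs]
      exact measurable_pi_apply (⟨s, hs⟩ : Finset.range (n + 1))
    · simp only [ext, dif_neg hs]
      exact measurable_const
  have hφ : Measurable fun y => (arChain ρ t (ext y), arChain ρ n (ext y)) := by fun_prop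
  have hψ : Measurable fun y : (({n + 1} : Finset ℕ) → ℝ) => y ⟨n + 1, by simp⟩ :=
    measurable_pi_apply _
  have hlocal : ∀ s ≤ n, ∀ z : ℕ → ℝ, arChain ρ s (ext fun i => z i) = arChain ρ s z := by
    intro s hs z
    refine arChain_congr ρ _ fun r hr => ?_
    have : r ≤ n := hr.trans hs
    simp [ext, this]
  convert h0.comp hφ hψ using 1
  ext z
  · exact (hlocal t h z).symm
  · exact (hlocal n le_rfl z).symm
  · rfl

lemma map_const_mul_gaussianReal {Ω : Type*} {mΩ : MeasurableSpace Ω} {P : Measure Ω} {X : Ω → ℝ}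
    {v : ℝ≥0} (hX : Measurable X) (h : P.map X = gaussianReal 0 v) (c : ℝ) :
    P.map (fun z => c * X z) = gaussianReal 0 ((c ^ 2).toNNReal * v) := by
  have := Measure.map_map (μ := P) (g := fun x : ℝ => c * x) (by fun_prop) hX
  rw [h, gaussianReal_map_const_mul, mul_zero] at this
  rw [Real.toNNReal_of_nonneg (sq_nonneg c)]
  exact this.symm

lemma map_arChain (ρ : ℝ) (hρ : ρ ∈ Set.Icc (0 : ℝ) 1) (n : ℕ) :
    noise.map (arChain ρ n) = gaussianReal 0 1 := by
  induction n with
  | zero => exact map_noise_eval 0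
  | succ n ih =>
    have hi : IndepFun (fun z => ρ * arChain ρ n z) (fun z => √(1 - ρ ^ 2) * z (n + 1)) noise :=
      (indepFun_arChain_noise ρ le_rfl).comp (φ := fun p : ℝ × ℝ => ρ * p.2)
        (ψ := fun y : ℝ => √(1 - ρ ^ 2) * y) (by fun_prop) (by fun_prop)
    have h1 := map_const_mul_gaussianReal (measurable_arChain ρ n) ih ρ
    have h2 := map_const_mul_gaussianReal (measurable_pi_apply (n + 1)) (map_noise_eval (n + 1))
      √(1 - ρ ^ 2)
    have h := gaussianReal_add_gaussianReal_of_indepFun hi h1 h2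
    have he : (arChain ρ (n + 1)) = (fun z => ρ * arChain ρ n z) +
      (fun z => √(1 - ρ ^ 2) * z (n + 1)) := rfl
    rw [he, h]
    congr 1
    · simp
    · ext
      have : (0:ℝ) ≤ 1 - ρ ^ 2 := by nlinarith [hρ.1, hρ.2]
      rw [mul_one, mul_one, NNReal.coe_add, Real.coe_toNNReal _ (sq_nonneg _),
        Real.coe_toNNReal _ (sq_nonneg _), Real.sq_sqrt this, NNReal.coe_one]
      ring

lemma map_arChain_noise (ρ : ℝ) (hρ : ρ ∈ Set.Icc (0 : ℝ) 1) (n : ℕ) :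
    noise.map (fun z => (arChain ρ n z, z (n + 1))) =
      (gaussianReal 0 1).prod (gaussianReal 0 1) := by
  have hi : IndepFun (arChain ρ n) (fun z => z (n + 1)) noise :=
    (indepFun_arChain_noise ρ le_rfl).comp (φ := Prod.snd) (ψ := id) (by fun_prop) (by fun_prop)
  rw [(indepFun_iff_map_prod_eq_prod_map_map (by fun_prop)
    (measurable_pi_apply (n + 1)).aemeasurable).1 hi, map_arChain ρ hρ, map_noise_eval]

lemma combination_var_nonneg {ρ : ℝ} (hρ : ρ ∈ Set.Icc (0 : ℝ) 1) (c d : ℝ) (k : ℕ) :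
    0 ≤ c ^ 2 + d ^ 2 + 2 * c * d * ρ ^ k := by
  have h0 : 0 ≤ ρ ^ k := pow_nonneg hρ.1 k
  have h1 : ρ ^ k ≤ 1 := pow_le_one₀ hρ.1 hρ.2
  nlinarith [mul_nonneg h0 (sq_nonneg (c + d)),
    mul_nonneg (sub_nonneg.2 h1) (add_nonneg (sq_nonneg c) (sq_nonneg d))]

/-- Unrolling the last step of the chain turns the coefficient `d` into `d * ρ` and adds an
independent Gaussian; hence the induction over `k` with `d` free. One-dimensional laws are enough,
since only sums of two fields are ever needed. -/
lemma map_combination_arChain {ρ : ℝ} (hρ : ρ ∈ Set.Icc (0 : ℝ) 1) (t k : ℕ) (c d : ℝ) :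
    noise.map (fun z => c * arChain ρ t z + d * arChain ρ (t + k) z) =
      gaussianReal 0 (c ^ 2 + d ^ 2 + 2 * c * d * ρ ^ k).toNNReal := by
  induction k generalizing d with
  | zero =>
    have h := map_const_mul_gaussianReal (measurable_arChain ρ t) (map_arChain ρ hρ t) (c + d)
    have he : (fun z => c * arChain ρ t z + d * arChain ρ (t + 0) z) =
      fun z => (c + d) * arChain ρ t z := by ext z; simp; ring
    rw [he, h]
    congr 1
    · ext
      rw [Real.coe_toNNReal _ (combination_var_nonneg hρ c d 0), mul_one,
        Real.coe_toNNReal _ (sq_nonneg _)]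
      ring
  | succ k ih =>
    have hi : IndepFun (fun z => c * arChain ρ t z + (d * ρ) * arChain ρ (t + k) z)
        (fun z => (d * √(1 - ρ ^ 2)) * z (t + k + 1)) noise :=
      (indepFun_arChain_noise ρ (Nat.le_add_right t k)).comp
        (φ := fun p : ℝ × ℝ => c * p.1 + (d * ρ) * p.2)
        (ψ := fun y : ℝ => (d * √(1 - ρ ^ 2)) * y) (by fun_prop) (by fun_prop)
    have h2 := map_const_mul_gaussianReal (measurable_pi_apply (t + k + 1))
      (map_noise_eval (t + k + 1)) (d * √(1 - ρ ^ 2))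
    have h := gaussianReal_add_gaussianReal_of_indepFun hi (ih (d * ρ)) h2
    have he : (fun z => c * arChain ρ t z + d * arChain ρ (t + (k + 1)) z) =
      (fun z => c * arChain ρ t z + (d * ρ) * arChain ρ (t + k) z) +
      (fun z => (d * √(1 - ρ ^ 2)) * z (t + k + 1)) := by
      ext z
      rw [← add_assoc t k 1]
      simp only [arChain, Pi.add_apply]
      ring
    rw [he, h]
    congr 1
    · simp
    · ext
      have : (0:ℝ) ≤ 1 - ρ ^ 2 := by nlinarith [hρ.1, hρ.2]
      rw [Real.coe_toNNReal _ (combination_var_nonneg hρ c d _), NNReal.coe_add,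
        Real.coe_toNNReal _ (combination_var_nonneg hρ c (d * ρ) _)]
      rw [mul_one, Real.coe_toNNReal _ (sq_nonneg _), mul_pow d √(1 - ρ ^ 2), Real.sq_sqrt this]
      ring

/-! ### The matrix chain and its fields -/

/-- Independent noise sequences for the entries of a row. -/
def rowNoise (N : ℕ) : Measure (Fin N → ℕ → ℝ) := Measure.pi fun _ => noise

instance (N : ℕ) : IsProbabilityMeasure (rowNoise N) := by unfold rowNoise; infer_instance

/-- Independent noise sequences for the entries of a matrix. -/
def matrixNoise (M N : ℕ) : Measure (Fin M → Fin N → ℕ → ℝ) := Measure.pi fun _ => rowNoise N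

instance (M N : ℕ) : IsProbabilityMeasure (matrixNoise M N) := by
  unfold matrixNoise; infer_instance

instance (M N : ℕ) : IsProbabilityMeasure (gaussianMatrix M N) := by
  unfold gaussianMatrix; infer_instance

/-- The matrix-valued stationary Gaussian chain. -/
def chainMatrix {M N : ℕ} (ρ : ℝ) (t : ℕ) (z : Fin M → Fin N → ℕ → ℝ) : DataMatrix M N :=
  fun i j => arChain ρ t (z i j)

@[fun_prop]
lemma measurable_chainMatrix {M N : ℕ} (ρ : ℝ) (t : ℕ) :
    Measurable (chainMatrix (M := M) (N := N) ρ t) := by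
  unfold chainMatrix; fun_prop

lemma map_chainMatrix_noise (M N : ℕ) {ρ : ℝ} (hρ : ρ ∈ Set.Icc (0 : ℝ) 1) (t : ℕ) :
    (matrixNoise M N).map (fun z => (chainMatrix ρ t z, fun i j => z i j (t + 1))) =
      (gaussianMatrix M N).prod (gaussianMatrix M N) := by
  have h1 := map_pi_prod (ι := Fin N) (measurable_arChain ρ t) (measurable_pi_apply (t + 1))
    (map_arChain_noise ρ hρ t)
  exact map_pi_prod (ι := Fin M) (μ := rowNoise N) (f := fun y j => arChain ρ t (y j))
    (g := fun y j => y j (t + 1)) (by fun_prop) (by fun_prop) h1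

lemma map_chainMatrix_succ (M N : ℕ) {ρ : ℝ} (hρ : ρ ∈ Set.Icc (0 : ℝ) 1) (t : ℕ) :
    (matrixNoise M N).map (fun z => (chainMatrix ρ t z, chainMatrix ρ (t + 1) z)) =
      correlatedGaussianMatrices M N ρ := by
  rw [correlatedGaussianMatrices, ← map_chainMatrix_noise M N hρ t,
    Measure.map_map (by fun_prop) (by fun_prop)]
  rfl

lemma map_chainMatrix (M N : ℕ) {ρ : ℝ} (hρ : ρ ∈ Set.Icc (0 : ℝ) 1) (t : ℕ) :
    (matrixNoise M N).map (chainMatrix ρ t) = gaussianMatrix M N := by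
  have h : chainMatrix (M := M) (N := N) ρ t =
    Prod.fst ∘ fun z => (chainMatrix ρ t z, fun i j => z i j (t + 1)) := rfl
  rw [h, ← Measure.map_map measurable_fst (by fun_prop), map_chainMatrix_noise M N hρ]
  simp

/-- The inner product of a sign vector with a row of the chain at time `t`. -/
def rowField {N : ℕ} (ρ : ℝ) (t : ℕ) (σ : Fin N → ℤˣ) (y : Fin N → ℕ → ℝ) : ℝ :=
  ∑ j, arChain ρ t (y j) * ((σ j : ℤ) : ℝ)

@[fun_prop]
lemma measurable_rowField {N : ℕ} (ρ : ℝ) (t : ℕ) (σ : Fin N → ℤˣ) :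
    Measurable (rowField ρ t σ) := by
  unfold rowField; fun_prop

lemma sign_sq (u : ℤˣ) : ((u : ℤ) : ℝ) ^ 2 = 1 := by
  rcases Int.units_eq_one_or u with h | h <;> simp [h]

lemma map_rowField {N : ℕ} {ρ : ℝ} (hρ : ρ ∈ Set.Icc (0 : ℝ) 1) (t : ℕ) (σ : Fin N → ℤˣ) :
    (rowNoise N).map (rowField ρ t σ) = gaussianReal 0 N := by
  have h := map_sum_pi_gaussianReal (ι := Fin N) (μ := fun _ => noise)
    (f := fun j y => arChain ρ t y * ((σ j : ℤ) : ℝ)) (v := fun _ => 1) (by fun_prop) fun j => by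
      have := map_const_mul_gaussianReal (measurable_arChain ρ t) (map_arChain ρ hρ t)
        ((σ j : ℤ) : ℝ)
      simp only [sign_sq, Real.toNNReal_one, mul_one] at this
      simpa only [mul_comm] using this
  unfold rowField rowNoise
  simpa using h

lemma sum_sign_mul_sign {N : ℕ} (σ τ : Fin N → ℤˣ) :
    ∑ j, ((σ j : ℤ) : ℝ) * ((τ j : ℤ) : ℝ) = N - 2 * (hammingDist σ τ : ℝ) := by
  have h : ∀ j, ((σ j : ℤ) : ℝ) * ((τ j : ℤ) : ℝ) = 1 - 2 * (if σ j ≠ τ j then 1 else 0) := by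
    intro j
    rcases Int.units_eq_one_or (σ j) with h1 | h1 <;>
      rcases Int.units_eq_one_or (τ j) with h2 | h2 <;> rw [h1, h2] <;> norm_num
  simp_rw [h, Finset.sum_sub_distrib, ← Finset.mul_sum, Finset.sum_boole]
  simp [hammingDist]

lemma map_rowField_add {N : ℕ} {ρ : ℝ} (hρ : ρ ∈ Set.Icc (0 : ℝ) 1) (t k : ℕ)
    (σ τ : Fin N → ℤˣ) :
    (rowNoise N).map (fun y => rowField ρ t σ y + rowField ρ (t + k) τ y) =
      gaussianReal 0 (2 * N + 2 * ρ ^ k * (N - 2 * (hammingDist σ τ : ℝ))).toNNReal := by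
  have h := map_sum_pi_gaussianReal (ι := Fin N) (μ := fun _ => noise)
    (f := fun j y => ((σ j : ℤ) : ℝ) * arChain ρ t y + ((τ j : ℤ) : ℝ) * arChain ρ (t + k) y)
    (by fun_prop) fun j => map_combination_arChain hρ t k _ _
  convert h using 1
  · simp only [rowNoise, rowField, ← Finset.sum_add_distrib, mul_comm]
  · congr 1
    rw [← Real.toNNReal_sum_of_nonneg fun j _ => combination_var_nonneg hρ _ _ k]
    congr 1
    simp only [sign_sq, Finset.sum_add_distrib, mul_assoc, ← Finset.mul_sum]
    simp only [← mul_assoc, ← Finset.sum_mul]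
    rw [← sum_sign_mul_sign]
    simp only [mul_assoc]
    simp
    ring

/-! ### Lower tails of Gaussians with reduced variance -/

lemma gaussianReal_one_real_Iio (κ : ℝ) :
    (gaussianReal 0 1).real (Set.Iio κ) = cdf (gaussianReal 0 1) κ := by
  have := nullSingletonClass_gaussianReal (μ := 0) (v := 1) one_ne_zero
  rw [cdf_eq_real, measureReal_def, measureReal_def, measure_congr Iio_ae_eq_Iic]

/-- The normalisation loses at most `√2 ≤ 2` because `β ≤ 1/2`; the exponent gains because `x²/(1-β)
≥ x² + βx² ≥ x² + βκ²`. -/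
lemma gaussianPDF_le {β κ x : ℝ} (hβ : β ∈ Set.Icc (0 : ℝ) (1 / 2)) (hκ : κ < 0) (hx : x < κ) :
    gaussianPDF 0 (1 - β).toNNReal x ≤
      ENNReal.ofReal (2 * Real.exp (-(β * κ ^ 2 / 2))) * gaussianPDF 0 1 x := by
  have hv : (0 : ℝ) < 1 - β := by linarith [hβ.2]
  rw [gaussianPDF, gaussianPDF, ← ENNReal.ofReal_mul (by positivity)]
  refine ENNReal.ofReal_le_ofReal ?_
  rw [gaussianPDFReal_def, gaussianPDFReal_def, Real.coe_toNNReal _ hv.le]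
  have h1 : (√(2 * Real.pi * (1 - β)))⁻¹ ≤ 2 * (√(2 * Real.pi * (1 : ℝ≥0)))⁻¹ := by
    have h0 : 0 < √(2 * Real.pi) := by positivity
    rw [Real.sqrt_mul (by positivity), mul_inv, NNReal.coe_one, mul_one, mul_comm]
    refine mul_le_mul_of_nonneg_right ?_ (by positivity)
    rw [inv_le_comm₀ (by positivity) (by norm_num)]
    refine Real.le_sqrt_of_sq_le ?_
    norm_num
    linarith [hβ.2]
  have h2 : Real.exp (-(x - 0) ^ 2 / (2 * (1 - β))) ≤
      Real.exp (-(β * κ ^ 2 / 2)) * Real.exp (-(x - 0) ^ 2 / (2 * (1 : ℝ≥0))) := by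
    rw [← Real.exp_add, Real.exp_le_exp, sub_zero, NNReal.coe_one, div_le_iff₀ (by positivity)]
    have h3 : κ ^ 2 ≤ x ^ 2 := by nlinarith
    have h4 : β * κ ^ 2 * (1 - β) ≤ β * x ^ 2 := by
      have : β * κ ^ 2 ≤ β * x ^ 2 := mul_le_mul_of_nonneg_left h3 hβ.1
      nlinarith [mul_nonneg hβ.1 (mul_nonneg hβ.1 (sq_nonneg κ))]
    nlinarith
  calc _ ≤ (2 * (√(2 * Real.pi * (1 : ℝ≥0)))⁻¹) * (Real.exp (-(β * κ ^ 2 / 2)) *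
        Real.exp (-(x - 0) ^ 2 / (2 * (1 : ℝ≥0)))) :=
        mul_le_mul h1 h2 (by positivity) (by positivity)
    _ = _ := by ring

/-- The threshold is negative, so enlarging the variance to `s²(1-β)` only enlarges the tail; then
the densities are compared. Used with `s = 2√N`. -/
lemma gaussianReal_real_Iio_le {β κ s : ℝ} {V : ℝ≥0} (hβ : β ∈ Set.Icc (0 : ℝ) (1 / 2))
    (hκ : κ < 0) (hs : 0 < s) (hV : (V : ℝ) ≤ s ^ 2 * (1 - β)) :
    (gaussianReal 0 V).real (Set.Iio (κ * s)) ≤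
      2 * Real.exp (-(β * κ ^ 2 / 2)) * cdf (gaussianReal 0 1) κ := by
  have hv : (0 : ℝ) < 1 - β := by linarith [hβ.2]
  -- Writing the laws as scalings of one standard Gaussian also covers the degenerate variance `V =
  -- 0`.
  have hmap : ∀ W : ℝ≥0, gaussianReal 0 W = (gaussianReal 0 1).map (fun x => √(W : ℝ) * x) := by
    intro W
    rw [gaussianReal_map_const_mul, mul_zero, mul_one]
    congr 1
    ext
    simp
  have h1 : (gaussianReal 0 V).real (Set.Iio (κ * s)) ≤
      (gaussianReal 0 (1 - β).toNNReal).real (Set.Iio κ) := by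
    rw [hmap V, hmap (1 - β).toNNReal, map_measureReal_apply (by fun_prop) measurableSet_Iio,
      map_measureReal_apply (by fun_prop) measurableSet_Iio]
    refine measureReal_mono fun x hx => ?_
    simp only [Set.mem_preimage, Set.mem_Iio] at hx ⊢
    rw [Real.coe_toNNReal _ hv.le]
    have hx0 : x < 0 := by
      by_contra h
      have h1 := mul_nonneg (Real.sqrt_nonneg (V : ℝ)) (not_lt.1 h)
      have h2 := mul_neg_of_neg_of_pos hκ hs
      linarith
    have hle : √(V : ℝ) ≤ s * √(1 - β) := by
      rw [Real.sqrt_le_left (by positivity), mul_pow, Real.sq_sqrt hv.le]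
      exact hV
    have h3 : s * √(1 - β) * x < κ * s :=
      (mul_le_mul_of_nonpos_right hle hx0.le).trans_lt hx
    by_contra h
    nlinarith [mul_le_mul_of_nonneg_left (not_lt.1 h) hs.le]
  refine h1.trans ?_
  have hne : (1 - β).toNNReal ≠ 0 := by simpa using hv
  rw [← gaussianReal_one_real_Iio, measureReal_def, measureReal_def]
  have h2 : gaussianReal 0 (1 - β).toNNReal (Set.Iio κ) ≤
      ENNReal.ofReal (2 * Real.exp (-(β * κ ^ 2 / 2))) * gaussianReal 0 1 (Set.Iio κ) := by
    rw [gaussianReal_apply _ hne, gaussianReal_apply _ one_ne_zero,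
      ← lintegral_const_mul _ (measurable_gaussianPDF _ _)]
    exact setLIntegral_mono ((measurable_gaussianPDF _ _).const_mul _)
      fun x hx => gaussianPDF_le hβ hκ hx
  have h3 := ENNReal.toReal_mono (ENNReal.mul_ne_top ENNReal.ofReal_ne_top (measure_ne_top _ _)) h2
  rwa [ENNReal.toReal_mul, ENNReal.toReal_ofReal (by positivity)] at h3

/-! ### Joint satisfaction of a row and of a matrix by a fixed tuple -/

/-- A Bonferroni-type bound for the probability that none of `m` events occurs. -/
lemma measureReal_iInter_compl_le {Ω : Type*} {mΩ : MeasurableSpace Ω} {P : Measure Ω}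
    [IsProbabilityMeasure P] {m : ℕ} {E : Fin m → Set Ω} (hE : ∀ k, MeasurableSet (E k)) {a b : ℝ}
    (ha : ∀ k, P.real (E k) = a) (hb : ∀ k l, k ≠ l → P.real (E k ∩ E l) ≤ b) (hb0 : 0 ≤ b) :
    P.real (⋂ k, (E k)ᶜ) ≤ 1 - (m * a - m ^ 2 * b) := by
  -- The part of `E k` outside all other events: these parts are disjoint and each loses at most `m
  -- * b`.
  let D : Fin m → Set Ω := fun k => E k \ ⋃ l ∈ Finset.univ.erase k, E l
  have hD : ∀ k, MeasurableSet (D k) := fun k =>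
    (hE k).diff (Finset.measurableSet_biUnion _ fun l _ => hE l)
  have hdisj : Pairwise (Function.onFun Disjoint D) := by
    intro k l hkl
    refine Set.disjoint_left.2 fun x hx hx' => hx.2 ?_
    simp only [Finset.mem_erase, Set.mem_iUnion]
    exact ⟨l, ⟨hkl.symm, Finset.mem_univ l⟩, hx'.1⟩
  have hDk : ∀ k, a - m * b ≤ P.real (D k) := by
    intro k
    have h1 : P.real (E k) ≤ P.real (D k) + P.real (⋃ l ∈ Finset.univ.erase k, E k ∩ E l) := by
      refine (measureReal_mono ?_).trans (measureReal_union_le _ _)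
      intro x hx
      by_cases h : x ∈ ⋃ l ∈ Finset.univ.erase k, E l
      · right
        simp only [Set.mem_iUnion] at h ⊢
        obtain ⟨l, hl, hxl⟩ := h
        exact ⟨l, hl, hx, hxl⟩
      · exact Or.inl ⟨hx, h⟩
    have h2 : P.real (⋃ l ∈ Finset.univ.erase k, E k ∩ E l) ≤ m * b := by
      refine (measureReal_biUnion_finset_le _ _).trans ?_
      refine (Finset.sum_le_card_nsmul _ _ b fun l hl =>
        hb k l (Finset.ne_of_mem_erase hl).symm).trans ?_
      rw [nsmul_eq_mul]
      refine mul_le_mul_of_nonneg_right ?_ hb0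
      exact_mod_cast (Finset.card_le_univ _).trans (by simp)
    rw [ha k] at h1
    linarith
  have hU : m * a - m ^ 2 * b ≤ P.real (⋃ k, E k) := by
    have h1 : P.real (⋃ k, D k) ≤ P.real (⋃ k, E k) :=
      measureReal_mono (Set.iUnion_mono fun k => Set.sdiff_subset)
    rw [measureReal_iUnion_fintype hdisj hD] at h1
    have h2 : ∑ _k : Fin m, (a - m * b) ≤ ∑ k, P.real (D k) := Finset.sum_le_sum fun k _ => hDk k
    simp only [Finset.sum_const, Finset.card_univ, Fintype.card_fin, nsmul_eq_mul] at h2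
    nlinarith
  rw [← Set.compl_iUnion, probReal_compl_eq_one_sub (MeasurableSet.iUnion hE)]
  linarith

/-- Either kind of separation gives `ρ^k (N - 2d) ≤ N(1 - 2β)`: distance bounds the second factor,
elapsed time the first, where `1/2 ≤ 1 - 2β` uses `β ≤ 1/4`. -/
lemma rowField_variance_le {N d k : ℕ} {ρ β : ℝ} (hρ : ρ ∈ Set.Icc (0 : ℝ) 1)
    (hβ : β ≤ 1 / 4) (h : β * N ≤ d ∨ ρ ^ k ≤ 1 / 2) :
    2 * N + 2 * ρ ^ k * (N - 2 * (d : ℝ)) ≤ (2 * √(N : ℝ)) ^ 2 * (1 - β) := by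
  have h0 : 0 ≤ ρ ^ k := pow_nonneg hρ.1 k
  have h1 : ρ ^ k ≤ 1 := pow_le_one₀ hρ.1 hρ.2
  have hN : (0 : ℝ) ≤ N := N.cast_nonneg
  have hd : (0 : ℝ) ≤ d := d.cast_nonneg
  rw [mul_pow, Real.sq_sqrt hN]
  have key : ρ ^ k * (N - 2 * (d : ℝ)) ≤ N * (1 - 2 * β) := by
    rcases h with h | h
    · have h2 : (N : ℝ) - 2 * d ≤ N * (1 - 2 * β) := by nlinarith
      have h3 : (0 : ℝ) ≤ N * (1 - 2 * β) := mul_nonneg hN (by linarith)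
      calc _ ≤ ρ ^ k * (N * (1 - 2 * β)) := mul_le_mul_of_nonneg_left h2 h0
        _ ≤ _ := mul_le_of_le_one_left h3 h1
    · nlinarith [mul_nonneg h0 hd, mul_le_mul_of_nonneg_right h hN,
        mul_le_mul_of_nonneg_left hβ hN]
  linarith

/-- The bound for the probability that `m` sign vectors, pairwise distant or used at distant times,
all satisfy the constraint of one row. -/
lemma rowNoise_real_le {N m : ℕ} (hN : 0 < N) {ρ β κ : ℝ} (hρ : ρ ∈ Set.Icc (0 : ℝ) 1)
    (hβ : β ∈ Set.Icc (0 : ℝ) (1 / 4)) (hκ : κ < 0) (t : Fin m → ℕ) (σ : Fin m → Fin N → ℤˣ)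
    (h : ∀ k l, k < l → t k ≤ t l ∧
      (β * N ≤ hammingDist (σ k) (σ l) ∨ ρ ^ (t l - t k) ≤ 1 / 2)) :
    (rowNoise N).real {y | ∀ k, κ * √(N : ℝ) ≤ rowField ρ (t k) (σ k) y} ≤
      1 - (m * cdf (gaussianReal 0 1) κ -
        m ^ 2 * (2 * Real.exp (-(β * κ ^ 2 / 2)) * cdf (gaussianReal 0 1) κ)) := by
  have hN' : (0 : ℝ) < N := by exact_mod_cast hN
  let E : Fin m → Set (Fin N → ℕ → ℝ) := fun k => {y | rowField ρ (t k) (σ k) y < κ * √(N : ℝ)}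
  have hE : ∀ k, MeasurableSet (E k) := fun k =>
    measurableSet_lt (measurable_rowField _ _ _) measurable_const
  have hΦ : 0 ≤ cdf (gaussianReal 0 1) κ := cdf_nonneg _ _
  have hlt : ∀ k l, k < l → (rowNoise N).real (E k ∩ E l) ≤
      2 * Real.exp (-(β * κ ^ 2 / 2)) * cdf (gaussianReal 0 1) κ := by
    intro k l hkl
    obtain ⟨hle, hor⟩ := h k l hkl
    obtain ⟨s, hs⟩ := Nat.exists_eq_add_of_le hle
    -- Two fields below `κ√N` have their sum below `2κ√N`, so a one-dimensional tail suffices.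
    have h1 : E k ∩ E l ⊆ (fun y => rowField ρ (t k) (σ k) y + rowField ρ (t k + s) (σ l) y) ⁻¹'
        Set.Iio (κ * (2 * √(N : ℝ))) := by
      rintro y ⟨h1, h2⟩
      simp only [E, Set.mem_ofPred_eq, hs] at h1 h2
      simp only [Set.mem_preimage, Set.mem_Iio]
      linarith
    refine (measureReal_mono h1).trans ?_
    rw [← map_measureReal_apply (by fun_prop) measurableSet_Iio, map_rowField_add hρ]
    refine gaussianReal_real_Iio_le ⟨hβ.1, by linarith [hβ.2]⟩ hκ (by positivity) ?_
    rw [hs, Nat.add_sub_cancel_left] at hor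
    rw [Real.coe_toNNReal']
    exact max_le (rowField_variance_le hρ hβ.2 hor)
      (mul_nonneg (sq_nonneg _) (by linarith [hβ.2]))
  have := measureReal_iInter_compl_le (P := rowNoise N) hE (a := cdf (gaussianReal 0 1) κ)
    (b := 2 * Real.exp (-(β * κ ^ 2 / 2)) * cdf (gaussianReal 0 1) κ) (fun k => ?_)
    (fun k l hkl => ?_) (by positivity)
  · convert this using 2
    ext y
    simp [E]
  · have h1 : E k = rowField ρ (t k) (σ k) ⁻¹' Set.Iio (κ * √(N : ℝ)) := rfl
    rw [h1, ← map_measureReal_apply (by fun_prop) measurableSet_Iio, map_rowField hρ,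
      ← gaussianReal_one_real_Iio]
    have h2 : gaussianReal 0 (N : ℝ≥0) = (gaussianReal 0 1).map (fun x => √(N : ℝ) * x) := by
      rw [gaussianReal_map_const_mul, mul_zero, mul_one]
      congr 1
      ext
      simp
    rw [h2, map_measureReal_apply (by fun_prop) measurableSet_Iio]
    congr 1
    ext x
    simp only [Set.mem_preimage, Set.mem_Iio]
    rw [mul_comm κ, mul_lt_mul_iff_right₀ (by positivity)]
  · rcases lt_or_gt_of_ne hkl with h1 | h1
    · exact hlt k l h1
    · rw [Set.inter_comm]
      exact hlt l k h1

lemma matrixNoise_real_le {M N m : ℕ} (hN : 0 < N) {ρ β κ : ℝ} (hρ : ρ ∈ Set.Icc (0 : ℝ) 1)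
    (hβ : β ∈ Set.Icc (0 : ℝ) (1 / 4)) (hκ : κ < 0) (t : Fin m → ℕ) (σ : Fin m → Fin N → ℤˣ)
    (h : ∀ k l, k < l → t k ≤ t l ∧
      (β * N ≤ hammingDist (σ k) (σ l) ∨ ρ ^ (t l - t k) ≤ 1 / 2)) {p : ℝ}
    (hp : 1 - (m * cdf (gaussianReal 0 1) κ -
      m ^ 2 * (2 * Real.exp (-(β * κ ^ 2 / 2)) * cdf (gaussianReal 0 1) κ)) ≤ p) :
    (matrixNoise M N).real {z | ∀ k, IsSolution κ (chainMatrix ρ (t k) z) (σ k)} ≤ p ^ M := by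
  have h1 : {z : Fin M → Fin N → ℕ → ℝ | ∀ k, IsSolution κ (chainMatrix ρ (t k) z) (σ k)} =
      Set.univ.pi fun _ => {y | ∀ k, κ * √(N : ℝ) ≤ rowField ρ (t k) (σ k) y} := by
    ext z
    simp only [Set.mem_ofPred_eq, Set.mem_pi, Set.mem_univ, true_imp_iff]
    exact forall_comm
  rw [h1, measureReal_def, matrixNoise, Measure.pi_pi, Finset.prod_const, Finset.card_univ,
    Fintype.card_fin, ENNReal.toReal_pow]
  exact pow_le_pow_left₀ measureReal_nonneg ((rowNoise_real_le hN hρ hβ hκ t σ h).trans hp) M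

/-! ### Counting linked tuples -/

/-- The generating function of the distance factorises over coordinates; at `x = b` it gives the
Chernoff bound for the ball volume. -/
lemma sum_pow_hammingDist {N : ℕ} (σ : Fin N → ℤˣ) (x : ℝ) :
    ∑ τ : Fin N → ℤˣ, x ^ hammingDist τ σ = (1 + x) ^ N := by
  have h1 : ∀ τ : Fin N → ℤˣ, x ^ hammingDist τ σ = ∏ j, if τ j ≠ σ j then x else 1 := by
    intro τ
    rw [Finset.prod_ite, Finset.prod_const, Finset.prod_const_one, mul_one]
    rfl
  have h2 : ∀ j, ∑ u : ℤˣ, (if u ≠ σ j then x else 1) = 1 + x := by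
    intro j
    rcases Int.units_eq_one_or (σ j) with h | h <;> rw [h] <;>
      rw [UnitsInt.univ, Finset.sum_pair (by decide)]
    · simp [show (-1 : ℤˣ) ≠ 1 by decide]
    · simp [show (1 : ℤˣ) ≠ -1 by decide, add_comm]
  have h3 := Finset.prod_univ_sum (fun _ : Fin N => (Finset.univ : Finset ℤˣ))
    (fun j u => if u ≠ σ j then x else 1)
  simp_rw [h1]
  rw [Fintype.piFinset_univ] at h3
  rw [← h3]
  simp_rw [h2]
  simp

/-- A bound for the volume of a Hamming ball of radius `b N`. -/
lemma card_hammingBall_le {N : ℕ} (σ : Fin N → ℤˣ) {b : ℝ} (hb : 0 < b) (hb1 : b ≤ 1) :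
    ((Finset.univ.filter fun τ : Fin N → ℤˣ => (hammingDist τ σ : ℝ) ≤ b * N).card : ℝ) ≤
      Real.exp (N * (b * (1 - Real.log b))) := by
  set S := Finset.univ.filter fun τ : Fin N → ℤˣ => (hammingDist τ σ : ℝ) ≤ b * N
  have h1 : (S.card : ℝ) * b ^ (b * N : ℝ) ≤ (1 + b) ^ N := by
    rw [← sum_pow_hammingDist σ b, ← nsmul_eq_mul]
    refine (Finset.card_nsmul_le_sum S (fun τ => b ^ hammingDist τ σ) _ fun τ hτ => ?_).trans
      (Finset.sum_le_univ_sum_of_nonneg fun τ => by positivity)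
    rw [← Real.rpow_natCast]
    exact Real.rpow_le_rpow_of_exponent_ge hb hb1 (Finset.mem_filter.1 hτ).2
  have h2 : (1 + b) ^ N ≤ Real.exp (N * b) := by
    rw [Real.exp_nat_mul]
    exact pow_le_pow_left₀ (by positivity) (by linarith [Real.add_one_le_exp b]) N
  have h3 : b ^ (b * N : ℝ) = Real.exp (Real.log b * (b * N)) := Real.rpow_def_of_pos hb _
  rw [h3] at h1
  calc (S.card : ℝ) = S.card * Real.exp (Real.log b * (b * N)) *
        Real.exp (-(Real.log b * (b * N))) := by
        rw [mul_assoc, ← Real.exp_add, add_neg_cancel, Real.exp_zero, mul_one]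
    _ ≤ Real.exp (N * b) * Real.exp (-(Real.log b * (b * N))) :=
        mul_le_mul_of_nonneg_right (h1.trans h2) (Real.exp_pos _).le
    _ = _ := by rw [← Real.exp_add]; congr 1; ring

/-- Every vector of the tuple but the first is within distance `r` of an earlier one. -/
def IsLinked {N n : ℕ} (r : ℝ) (σ : Fin n → Fin N → ℤˣ) : Prop :=
  ∀ k : Fin n, 0 < (k : ℕ) → ∃ l < k, (hammingDist (σ k) (σ l) : ℝ) ≤ r

open Classical in
-- The first vector is free (`2^N` choices); each later one lies in a ball around one of at most `m`
-- earlier vectors, so forgetting the last vector is at most `m * V` to one.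
lemma card_isLinked_le {N m V : ℕ} {r : ℝ}
    (hV : ∀ σ : Fin N → ℤˣ, (Finset.univ.filter fun τ : Fin N → ℤˣ =>
      (hammingDist τ σ : ℝ) ≤ r).card ≤ V) (n : ℕ) (hn : n + 1 ≤ m) :
    (Finset.univ.filter fun σ : Fin (n + 1) → Fin N → ℤˣ => IsLinked r σ).card ≤
      (m * V) ^ n * 2 ^ N := by
  induction n with
  | zero =>
    refine (Finset.card_le_univ _).trans ?_
    simp
  | succ n ih =>
    have h1 := Finset.card_le_mul_card_image (f := fun σ : Fin (n + 2) → Fin N → ℤˣ => Fin.init σ)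
      (Finset.univ.filter fun σ : Fin (n + 2) → Fin N → ℤˣ => IsLinked r σ) (m * V) ?_
    · refine h1.trans ?_
      rw [pow_succ', mul_assoc (m * V)]
      refine Nat.mul_le_mul_left _ ((Finset.card_le_card ?_).trans (ih (by omega)))
      intro σ hσ
      simp only [Finset.mem_image, Finset.mem_filter, Finset.mem_univ, true_and] at hσ ⊢
      obtain ⟨τ, hτ, rfl⟩ := hσ
      intro k hk
      obtain ⟨l, hl, hd⟩ := hτ k.castSucc hk
      have hlt : (l : ℕ) < n + 1 := lt_trans (Fin.lt_def.1 hl) k.isLt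
      exact ⟨⟨l, hlt⟩, hl, hd⟩
    · intro a _
      have h2 : (Finset.univ.filter (fun σ : Fin (n + 2) → Fin N → ℤˣ => IsLinked r σ)).filter
          (fun σ => Fin.init σ = a) ⊆ (Finset.univ.biUnion fun l : Fin (n + 1) =>
            Finset.univ.filter fun τ : Fin N → ℤˣ => (hammingDist τ (a l) : ℝ) ≤ r).image
            (fun τ => (Fin.snoc a τ : Fin (n + 2) → Fin N → ℤˣ)) := by
        intro σ hσ
        simp only [Finset.mem_filter, Finset.mem_univ, true_and, Finset.mem_image,
          Finset.mem_biUnion] at hσ ⊢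
        obtain ⟨hσ, rfl⟩ := hσ
        obtain ⟨l, hl, hd⟩ := hσ (Fin.last (n + 1)) (by simp)
        refine ⟨σ (Fin.last (n + 1)), ⟨⟨l, Fin.lt_def.1 hl⟩, ?_⟩, Fin.snoc_init_self σ⟩
        exact hd
      refine (Finset.card_le_card h2).trans (Finset.card_image_le.trans
        (Finset.card_biUnion_le.trans ((Finset.sum_le_card_nsmul _ _ V fun l _ => hV _).trans ?_)))
      simp only [Finset.card_univ, Fintype.card_fin, smul_eq_mul]
      exact Nat.mul_le_mul_right V (by omega)

/-! ### Extracting a ladder from a slow path -/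

/-- A slowly moving path of sign vectors contains a linked tuple of vectors which are pairwise far
from each other or visited at distant times. -/
lemma exists_ladder {N T K : ℕ} {r ε : ℝ} (hr : 0 ≤ r) (hK : 0 < K)
    (θ : ℕ → Fin N → ℤˣ) (hθ : ∀ t < T, (hammingDist (θ t) (θ (t + 1)) : ℝ) ≤ ε) (n : ℕ)
    (hT : n * K ≤ T) :
    ∃ t : Fin (n + 1) → ℕ, (∀ k, t k ≤ k * K) ∧
      (∀ k l, k < l → t k ≤ t l ∧
        (r ≤ hammingDist (θ (t k)) (θ (t l)) ∨ K ≤ t l - t k)) ∧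
      IsLinked (r + ε) fun k => θ (t k) := by
  classical
  induction n with
  | zero =>
    refine ⟨fun _ => 0, fun _ => Nat.zero_le _, fun k l hkl => ?_, fun k hk => ?_⟩ <;> omega
  | succ n ih =>
    obtain ⟨t, ht1, ht2, ht3⟩ := ih (by nlinarith)
    set a := t (Fin.last n) with ha
    have hmono : ∀ k, t k ≤ a := fun k => by
      rcases eq_or_lt_of_le (Fin.le_last k) with h | h
      · rw [h]
      · exact (ht2 k _ h).1
    -- The next rung is the first later time that is far from all rungs so far, or at the latest `K`
    -- steps after the last one.
    let Q : ℕ → Prop := fun s => a < s ∧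
      ((∀ i, r ≤ (hammingDist (θ (t i)) (θ s) : ℝ)) ∨ a + K ≤ s)
    have hQ : ∃ s, Q s := ⟨a + K, by omega, Or.inr le_rfl⟩
    set s := Nat.find hQ with hs
    have hs1 : Q s := Nat.find_spec hQ
    have hsK : s ≤ a + K := Nat.find_min' hQ ⟨by omega, Or.inr le_rfl⟩
    have haK : a ≤ n * K := by simpa using ht1 (Fin.last n)
    have hsT : s ≤ (n + 1) * K := by rw [add_mul, one_mul]; omega
    -- Just before the first such time the path was still within `r` of some rung (of the last one
    -- itself if `u = a`), and one step adds at most `ε`.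
    have hlink : ∃ i, (hammingDist (θ s) (θ (t i)) : ℝ) ≤ r + ε := by
      obtain ⟨u, hu⟩ : ∃ u, s = u + 1 := ⟨s - 1, by have := hs1.1; omega⟩
      have hstep : (hammingDist (θ u) (θ s) : ℝ) ≤ ε := by
        rw [hu]; exact hθ u (by omega)
      have hi : ∃ i, (hammingDist (θ (t i)) (θ u) : ℝ) ≤ r := by
        by_cases hua : u = a
        · refine ⟨Fin.last n, ?_⟩
          rw [← ha, hua, hammingDist_self]
          simpa using hr
        · have hnot : ¬ Q u := Nat.find_min hQ (by omega)
          have hau : a < u := by have := hs1.1; omega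
          have h3 : ¬ ∀ i, r ≤ (hammingDist (θ (t i)) (θ u) : ℝ) := fun h => hnot ⟨hau, Or.inl h⟩
          push Not at h3
          obtain ⟨i, hi⟩ := h3
          exact ⟨i, hi.le⟩
      obtain ⟨i, hi⟩ := hi
      refine ⟨i, ?_⟩
      rw [hammingDist_comm]
      have htri : (hammingDist (θ (t i)) (θ s) : ℝ) ≤
          hammingDist (θ (t i)) (θ u) + hammingDist (θ u) (θ s) := by
        exact_mod_cast hammingDist_triangle _ _ _
      linarith
    refine ⟨Fin.snoc t s, ?_, ?_, ?_⟩
    · intro k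
      refine Fin.lastCases ?_ (fun k => ?_) k
      · simpa using hsT
      · simpa using ht1 k
    · intro k l
      refine Fin.lastCases (fun hkl => ?_) (fun l hkl => ?_) l
      · have hk : (k : ℕ) < n + 1 := hkl
        obtain ⟨k, rfl⟩ : ∃ k' : Fin (n + 1), k = k'.castSucc := ⟨⟨k, hk⟩, rfl⟩
        simp only [Fin.snoc_castSucc, Fin.snoc_last]
        have := hmono k
        refine ⟨by have := hs1.1; omega, ?_⟩
        rcases hs1.2 with h | h
        · exact Or.inl (h k)
        · exact Or.inr (by omega)
      · have hk : (k : ℕ) < n + 1 := lt_trans (Fin.lt_def.1 hkl) l.isLt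
        obtain ⟨k, rfl⟩ : ∃ k' : Fin (n + 1), k = k'.castSucc := ⟨⟨k, hk⟩, rfl⟩
        simp only [Fin.snoc_castSucc]
        exact ht2 k l hkl
    · intro k
      refine Fin.lastCases (fun _ => ?_) (fun k hk => ?_) k
      · obtain ⟨i, hi⟩ := hlink
        exact ⟨i.castSucc, Fin.castSucc_lt_last i, by simpa using hi⟩
      · obtain ⟨l, hl, hd⟩ := ht3 k hk
        exact ⟨l.castSucc, hl, by simpa using hd⟩

/-! ### Unsatisfiable instances at small sizes -/

instance : (gaussianReal 0 1).IsOpenPosMeasure :=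
  (gaussianReal_absolutelyContinuous' 0 one_ne_zero).isOpenPosMeasure

instance (M N : ℕ) : (gaussianMatrix M N).IsOpenPosMeasure := by
  have : (Measure.pi fun _ : Fin N => gaussianReal 0 1).IsOpenPosMeasure :=
    Measure.pi.isOpenPosMeasure _
  exact Measure.pi.isOpenPosMeasure _

/-- Unsatisfiability is an open condition, so one instance is enough. Two rows with opposite large
entries in one column, and zeros elsewhere, cannot both be satisfied; hence `2 ≤ M`. -/
lemma gaussianMatrix_no_solution_pos {M N : ℕ} (hM : 2 ≤ M) (hN : 0 < N) (κ : ℝ) :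
    0 < (gaussianMatrix M N).real {X | ∀ θ, ¬ IsSolution κ X θ} := by
  have hopen : IsOpen {X : DataMatrix M N | ∀ θ, ¬ IsSolution κ X θ} := by
    have : {X : DataMatrix M N | ∀ θ, ¬ IsSolution κ X θ} =
        ⋂ θ : Fin N → ℤˣ, ⋃ i, {X | ∑ j, X i j * ((θ j : ℤ) : ℝ) < κ * √(N : ℝ)} := by
      ext X
      simp [IsSolution]
    rw [this]
    refine isOpen_iInter_of_finite fun θ => isOpen_iUnion fun i => ?_
    exact isOpen_lt (by fun_prop) continuous_const
  have hne : {X : DataMatrix M N | ∀ θ, ¬ IsSolution κ X θ}.Nonempty := by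
    set B : ℝ := |κ * √(N : ℝ)| + 1
    let j₀ : Fin N := ⟨0, hN⟩
    refine ⟨fun i j => if j = j₀ then (if (i : ℕ) = 0 then B else -B) else 0, fun θ hθ => ?_⟩
    have h0 := hθ ⟨0, by omega⟩
    have h1 := hθ ⟨1, by omega⟩
    simp only [ite_mul, zero_mul, Finset.sum_ite_eq', Finset.mem_univ, if_true] at h0 h1
    have hB : -B < κ * √(N : ℝ) := by
      have := neg_abs_le (κ * √(N : ℝ))
      simp only [B]
      linarith
    rcases Int.units_eq_one_or (θ j₀) with h | h <;> simp [h] at h0 h1 <;> linarith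
  exact ENNReal.toReal_pos (hopen.measure_pos _ hne).ne' (measure_ne_top _ _)

lemma exists_lt_no_solution_prob (κ : ℝ) (M₁ N₁ : ℕ) :
    ∃ p > (0 : ℝ), ∀ M N : ℕ, 2 ≤ M → M ≤ M₁ → 0 < N → N ≤ N₁ →
      p < (gaussianMatrix M N).real {X | ∀ θ, ¬ IsSolution κ X θ} := by
  have h : ∀ᶠ p in 𝓝[>] (0 : ℝ), ∀ q ∈ Finset.Icc 2 M₁ ×ˢ Finset.Icc 1 N₁,
      p < (gaussianMatrix q.1 q.2).real {X | ∀ θ, ¬ IsSolution κ X θ} := by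
    rw [Filter.eventually_all_finset]
    intro q hq
    simp only [Finset.mem_product, Finset.mem_Icc] at hq
    exact nhdsWithin_le_nhds (eventually_lt_nhds
      (gaussianMatrix_no_solution_pos hq.1.1 hq.2.1 κ))
  obtain ⟨p, hp, hp0⟩ := (h.and self_mem_nhdsWithin).exists
  refine ⟨p, hp0, fun M N h1 h2 h3 h4 => hp (M, N) ?_⟩
  simp only [Finset.mem_product, Finset.mem_Icc]
  exact ⟨⟨h1, h2⟩, h3, h4⟩

/-- An algorithm cannot succeed with a probability exceeding that of satisfiability. -/
lemma IsStableAt.no_solution_le {Ω : Type*} [MeasurableSpace Ω] {P : Measure Ω}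
    [IsProbabilityMeasure P] {M N : ℕ} {κ ρ pf pst f L : ℝ}
    {A : DataMatrix M N → Ω → (Fin N → ℤˣ)} (h : IsStableAt P κ ρ pf pst f L A) :
    (gaussianMatrix M N).real {X | ∀ θ, ¬ IsSolution κ X θ} ≤ pf := by
  set U := {X : DataMatrix M N | ∀ θ, ¬ IsSolution κ X θ}
  have hU : MeasurableSet U := by
    have : U = ⋂ θ : Fin N → ℤˣ, ⋃ i, {X | ∑ j, X i j * ((θ j : ℤ) : ℝ) < κ * √(N : ℝ)} := by
      ext X
      simp [U, IsSolution]
    rw [this]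
    exact MeasurableSet.iInter fun θ => MeasurableSet.iUnion fun i =>
      measurableSet_lt (by fun_prop) measurable_const
  have h1 : ((gaussianMatrix M N).prod P).real {q | IsSolution κ q.1 (A q.1 q.2)} ≤
      ((gaussianMatrix M N).prod P).real (Uᶜ ×ˢ Set.univ) := by
    refine measureReal_mono fun q hq => ⟨fun hU => hU _ hq, trivial⟩
  rw [measureReal_prod_prod, probReal_univ, mul_one, probReal_compl_eq_one_sub hU] at h1
  linarith [h.success]

/-! ### Concentration of the Frobenius norm -/

lemma integral_exp_sq_gaussianReal :
    Integrable (fun x : ℝ => Real.exp (x ^ 2 / 4)) (gaussianReal 0 1) ∧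
    ∫ x, Real.exp (x ^ 2 / 4) ∂(gaussianReal 0 1) = √2 := by
  have he : (fun x : ℝ => gaussianPDFReal 0 1 x • Real.exp (x ^ 2 / 4)) =
      fun x => (√(2 * Real.pi))⁻¹ * Real.exp (-(1 / 4) * x ^ 2) := by
    ext x
    rw [gaussianPDFReal_def, smul_eq_mul, mul_assoc, ← Real.exp_add]
    simp only [NNReal.coe_one, mul_one, sub_zero]
    congr 2
    ring
  constructor
  · rw [gaussianReal_of_var_ne_zero _ one_ne_zero]
    rw [gaussianPDF_def]
    rw [integrable_withDensity_iff_integrable_smul₀' (by fun_prop) (by simp)]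
    simp only [ENNReal.toReal_ofReal (gaussianPDFReal_nonneg _ _ _)]
    rw [he]
    exact (integrable_exp_neg_mul_sq (by norm_num)).const_mul _
  · rw [integral_gaussianReal_eq_integral_smul one_ne_zero, he, integral_const_mul,
      integral_gaussian, ← Real.sqrt_inv, ← Real.sqrt_mul (by positivity)]
    congr 1
    field_simp
    norm_num

/-- Chernoff bound with `exp(x²/4)`, whose mean is `√2`: the threshold 4 per entry gives the ratio
`√2 / e < 1`. -/
lemma gaussianMatrix_frobNorm_tail (M N : ℕ) :
    (gaussianMatrix M N).real {X | 4 * (M * N : ℝ) < ∑ i, ∑ j, X i j ^ 2} ≤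
      (√2 / Real.exp 1) ^ (M * N) := by
  obtain ⟨hint, hval⟩ := integral_exp_sq_gaussianReal
  have hintrow : Integrable (fun y : Fin N → ℝ => ∏ j, Real.exp (y j ^ 2 / 4))
      (Measure.pi fun _ => gaussianReal 0 1) := Integrable.fintype_prod fun _ => hint
  have hintmat : Integrable (fun X : DataMatrix M N => ∏ i, ∏ j, Real.exp (X i j ^ 2 / 4))
      (gaussianMatrix M N) := Integrable.fintype_prod fun _ => hintrow
  have hI : ∫ X : DataMatrix M N, ∏ i, ∏ j, Real.exp (X i j ^ 2 / 4) ∂(gaussianMatrix M N) =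
      √2 ^ (M * N) := by
    unfold gaussianMatrix
    rw [integral_fintype_prod_eq_pow (fun y : Fin N → ℝ => ∏ j, Real.exp (y j ^ 2 / 4)),
      integral_fintype_prod_eq_pow (fun x : ℝ => Real.exp (x ^ 2 / 4)), hval]
    simp [← pow_mul, mul_comm]
  have hmarkov := mul_meas_ge_le_integral_of_nonneg
    (Eventually.of_forall fun X => by positivity) hintmat (Real.exp (M * N))
  rw [hI] at hmarkov
  have hsub : {X : DataMatrix M N | 4 * (M * N : ℝ) < ∑ i, ∑ j, X i j ^ 2} ⊆
      {X | Real.exp (M * N) ≤ ∏ i, ∏ j, Real.exp (X i j ^ 2 / 4)} := by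
    intro X hX
    simp only [Set.mem_ofPred_eq, ← Real.exp_sum, ← Finset.sum_div, Real.exp_le_exp] at hX ⊢
    linarith
  have h1 := measureReal_mono (μ := gaussianMatrix M N) hsub
  have he : Real.exp (M * N) = Real.exp 1 ^ (M * N) := by
    rw [← Real.exp_nat_mul]; simp
  rw [div_pow, le_div_iff₀ (by positivity), ← he, mul_comm]
  exact (mul_le_mul_of_nonneg_left h1 (Real.exp_pos _).le).trans hmarkov

/-! ### Measurability of the success and stability events -/

instance : DiscreteMeasurableSpace ℤˣ where
  forall_measurableSet s :=
    ⟨Units.val '' s, MeasurableSet.of_discrete, Set.preimage_image_eq s Units.val_injective⟩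

lemma measurable_hammingDist {E : Type*} [MeasurableSpace E] {N : ℕ} {f g : E → Fin N → ℤˣ}
    (hf : Measurable f) (hg : Measurable g) :
    Measurable fun q => (hammingDist (f q) (g q) : ℝ) := by
  let F : (Fin N → ℤˣ) × (Fin N → ℤˣ) → ℝ := fun p => (hammingDist p.1 p.2 : ℝ)
  have hF : Measurable F := by
    clear_value F
    exact Measurable.of_discrete
  have h : (fun q => (hammingDist (f q) (g q) : ℝ)) = F ∘ fun q => (f q, g q) := rfl
  rw [h]
  exact hF.comp (hf.prodMk hg)

section Measurability

variable {Ω : Type*} [MeasurableSpace Ω] {M N : ℕ} {A : DataMatrix M N → Ω → (Fin N → ℤˣ)}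

lemma measurableSet_success (hA : Measurable (Function.uncurry A)) (κ : ℝ) :
    MeasurableSet {q : DataMatrix M N × Ω | IsSolution κ q.1 (A q.1 q.2)} := by
  have h1 : ∀ j, Measurable fun q : DataMatrix M N × Ω => ((A q.1 q.2 j : ℤ) : ℝ) := fun j =>
    (Measurable.of_discrete (f := fun u : ℤˣ => ((u : ℤ) : ℝ))).comp
      ((measurable_pi_apply j).comp hA)
  have h2 : {q : DataMatrix M N × Ω | IsSolution κ q.1 (A q.1 q.2)} =
      ⋂ i, {q | κ * √(N : ℝ) ≤ ∑ j, q.1 i j * ((A q.1 q.2 j : ℤ) : ℝ)} := by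
    ext q
    simp [IsSolution]
  rw [h2]
  exact MeasurableSet.iInter fun i => measurableSet_le measurable_const
    (Finset.measurable_sum _ fun j _ => (by fun_prop : Measurable
      fun q : DataMatrix M N × Ω => q.1 i j).mul (h1 j))

@[fun_prop]
lemma measurable_frobNorm : Measurable (frobNorm (M := M) (N := N)) := by
  unfold frobNorm
  fun_prop

lemma measurableSet_stability (hA : Measurable (Function.uncurry A)) (f L : ℝ) :
    MeasurableSet {q : (DataMatrix M N × DataMatrix M N) × Ω |
      (hammingDist (A q.1.1 q.2) (A q.1.2 q.2) : ℝ) ≤ f + L * frobNorm (q.1.1 - q.1.2)} := by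
  have h1 : Measurable fun q : (DataMatrix M N × DataMatrix M N) × Ω => A q.1.1 q.2 :=
    hA.comp ((measurable_fst.comp measurable_fst).prodMk measurable_snd)
  have h2 : Measurable fun q : (DataMatrix M N × DataMatrix M N) × Ω => A q.1.2 q.2 :=
    hA.comp ((measurable_snd.comp measurable_fst).prodMk measurable_snd)
  have h4 : Measurable fun q : (DataMatrix M N × DataMatrix M N) × Ω =>
      (hammingDist (A q.1.1 q.2) (A q.1.2 q.2) : ℝ) := measurable_hammingDist h1 h2
  have h5 : Measurable fun q : (DataMatrix M N × DataMatrix M N) × Ω =>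
      frobNorm (q.1.1 - q.1.2) :=
    measurable_frobNorm.comp (measurable_fst.fst.sub measurable_fst.snd)
  exact measurableSet_le h4 ((h5.const_mul L).const_add f)

end Measurability

/-! ### Exceptional events along the chain -/

section Events

variable {Ω : Type*} [MeasurableSpace Ω] {P : Measure Ω} [IsProbabilityMeasure P] {M N : ℕ}
  {κ ρ pf pst f L : ℝ} {A : DataMatrix M N → Ω → (Fin N → ℤˣ)}

lemma map_prod_left {E F : Type*} [MeasurableSpace E] [MeasurableSpace F] {μ : Measure E}
    [IsProbabilityMeasure μ] {ν : Measure F} {g : E → F} (hg : Measurable g) (h : μ.map g = ν) :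
    (μ.prod P).map (fun q => (g q.1, q.2)) = ν.prod P := by
  have := Measure.map_prod_map μ P hg measurable_id
  rw [h, Measure.map_id] at this
  exact this.symm

/-- Stationarity carries the success bound to every time of the chain, with the same `ω` throughout.
-/
lemma IsStableAt.failure_le (h : IsStableAt P κ ρ pf pst f L A) (hρ : ρ ∈ Set.Icc (0 : ℝ) 1)
    (t : ℕ) :
    ((matrixNoise M N).prod P).real
      {q | ¬ IsSolution κ (chainMatrix ρ t q.1) (A (chainMatrix ρ t q.1) q.2)} ≤ pf := by
  have hm := measurableSet_success h.measurable κ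
  have hs := h.success
  rw [← map_prod_left (measurable_chainMatrix ρ t) (map_chainMatrix M N hρ t),
    map_measureReal_apply (by fun_prop) hm] at hs
  have hc := probReal_compl_eq_one_sub (μ := (matrixNoise M N).prod P)
    (hm.preimage (by fun_prop : Measurable fun q : (Fin M → Fin N → ℕ → ℝ) × Ω =>
      (chainMatrix ρ t q.1, q.2)))
  refine le_trans (le_of_eq hc) ?_
  linarith

lemma IsStableAt.instability_le (h : IsStableAt P κ ρ pf pst f L A)
    (hρ : ρ ∈ Set.Icc (0 : ℝ) 1) (t : ℕ) :
    ((matrixNoise M N).prod P).real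
      {q | ¬ (hammingDist (A (chainMatrix ρ t q.1) q.2) (A (chainMatrix ρ (t + 1) q.1) q.2) : ℝ) ≤
        f + L * frobNorm (chainMatrix ρ t q.1 - chainMatrix ρ (t + 1) q.1)} ≤ pst := by
  have hm := measurableSet_stability h.measurable f L
  have hs := h.stability
  rw [← map_prod_left (by fun_prop) (map_chainMatrix_succ M N hρ t),
    map_measureReal_apply (by fun_prop) hm] at hs
  have hc := probReal_compl_eq_one_sub (μ := (matrixNoise M N).prod P)
    (hm.preimage (by fun_prop : Measurable fun q : (Fin M → Fin N → ℕ → ℝ) × Ω =>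
      ((chainMatrix ρ t q.1, chainMatrix ρ (t + 1) q.1), q.2)))
  refine le_trans (le_of_eq hc) ?_
  linarith

lemma measureReal_prod_fst {E F : Type*} [MeasurableSpace E] [MeasurableSpace F] (μ : Measure E)
    [IsProbabilityMeasure μ] {ν : Measure F} {g : E → F} (hg : Measurable g) (h : μ.map g = ν)
    {s : Set F} (hs : MeasurableSet s) :
    (μ.prod P).real {q | g q.1 ∈ s} = ν.real s := by
  have h1 : {q : E × Ω | g q.1 ∈ s} = (g ⁻¹' s) ×ˢ Set.univ := by ext; simp
  rw [h1, measureReal_prod_prod, probReal_univ, mul_one, ← h, map_measureReal_apply hg hs]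

lemma measurableSet_frobSq_tail (M N : ℕ) :
    MeasurableSet {X : DataMatrix M N | 4 * (M * N : ℝ) < ∑ i, ∑ j, X i j ^ 2} :=
  measurableSet_lt measurable_const (by fun_prop)

variable (P) in
lemma chainMatrix_frobSq_tail (M N : ℕ) (hρ : ρ ∈ Set.Icc (0 : ℝ) 1) (t : ℕ) :
    ((matrixNoise M N).prod P).real
      {q | 4 * (M * N : ℝ) < ∑ i, ∑ j, chainMatrix ρ t q.1 i j ^ 2} ≤
      (√2 / Real.exp 1) ^ (M * N) :=
  (measureReal_prod_fst (P := P) _ (measurable_chainMatrix ρ t) (map_chainMatrix M N hρ t)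
    (measurableSet_frobSq_tail M N)).trans_le (gaussianMatrix_frobNorm_tail M N)

variable (P) in
lemma increment_frobSq_tail (M N : ℕ) (t : ℕ) :
    ((matrixNoise M N).prod P).real
      {q | 4 * (M * N : ℝ) < ∑ i, ∑ j, q.1 i j (t + 1) ^ 2} ≤
      (√2 / Real.exp 1) ^ (M * N) := by
  have h1 : (matrixNoise M N).map (fun z => fun i j => z i j (t + 1)) = gaussianMatrix M N := by
    have h : (fun (z : Fin M → Fin N → ℕ → ℝ) i j => z i j (t + 1)) =
      -- The correlation 0 is arbitrary: only the second marginal matters.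
      Prod.snd ∘ fun z => (chainMatrix 0 t z, fun i j => z i j (t + 1)) := rfl
    rw [h, ← Measure.map_map measurable_snd (by fun_prop),
      map_chainMatrix_noise M N ⟨le_rfl, zero_le_one⟩]
    simp
  exact (measureReal_prod_fst (P := P) _ (by fun_prop) h1
    (measurableSet_frobSq_tail M N)).trans_le (gaussianMatrix_frobNorm_tail M N)

/-- One step is `(1-ρ)X - √(1-ρ²)Z`. With `(a-b)² ≤ 2a² + 2b²`, `(1-ρ)² ≤ 1-ρ` and `1-ρ² ≤ 2(1-ρ)`
the constants add up to `2 + 4 = 6`. -/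
lemma frobNorm_chainMatrix_sub_le (hρ : ρ ∈ Set.Icc (0 : ℝ) 1) (t : ℕ)
    {z : Fin M → Fin N → ℕ → ℝ} {R : ℝ} (h1 : ∑ i, ∑ j, chainMatrix ρ t z i j ^ 2 ≤ R)
    (h2 : ∑ i, ∑ j, z i j (t + 1) ^ 2 ≤ R) :
    frobNorm (chainMatrix ρ t z - chainMatrix ρ (t + 1) z) ≤ √(6 * (1 - ρ) * R) := by
  refine Real.sqrt_le_sqrt ?_
  have hs : (0 : ℝ) ≤ 1 - ρ ^ 2 := by nlinarith [hρ.1, hρ.2]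
  have hρ1 : 0 ≤ 1 - ρ := by linarith [hρ.2]
  have h3 : ∀ i j, (chainMatrix ρ t z - chainMatrix ρ (t + 1) z) i j ^ 2 ≤
      2 * (1 - ρ) * chainMatrix ρ t z i j ^ 2 + 4 * (1 - ρ) * z i j (t + 1) ^ 2 := by
    intro i j
    have he : (chainMatrix ρ t z - chainMatrix ρ (t + 1) z) i j =
        (1 - ρ) * chainMatrix ρ t z i j - √(1 - ρ ^ 2) * z i j (t + 1) := by
      simp only [Pi.sub_apply, chainMatrix, arChain]
      ring
    rw [he]
    have h4 : ((1 - ρ) * chainMatrix ρ t z i j - √(1 - ρ ^ 2) * z i j (t + 1)) ^ 2 ≤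
        2 * ((1 - ρ) ^ 2 * chainMatrix ρ t z i j ^ 2) +
        2 * (√(1 - ρ ^ 2) ^ 2 * z i j (t + 1) ^ 2) := by
      nlinarith [sq_nonneg ((1 - ρ) * chainMatrix ρ t z i j + √(1 - ρ ^ 2) * z i j (t + 1))]
    rw [Real.sq_sqrt hs] at h4
    have h5 : (1 - ρ) ^ 2 ≤ 1 - ρ := by nlinarith [hρ.1]
    have h6 : 1 - ρ ^ 2 ≤ 2 * (1 - ρ) := by nlinarith [hρ.2, sq_nonneg (1 - ρ)]
    have h7 := mul_le_mul_of_nonneg_right h5 (sq_nonneg (chainMatrix ρ t z i j))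
    have h8 := mul_le_mul_of_nonneg_right h6 (sq_nonneg (z i j (t + 1)))
    linarith
  calc _ ≤ ∑ i, ∑ j, (2 * (1 - ρ) * chainMatrix ρ t z i j ^ 2 +
        4 * (1 - ρ) * z i j (t + 1) ^ 2) :=
        Finset.sum_le_sum fun i _ => Finset.sum_le_sum fun j _ => h3 i j
    _ = 2 * (1 - ρ) * ∑ i, ∑ j, chainMatrix ρ t z i j ^ 2 +
        4 * (1 - ρ) * ∑ i, ∑ j, z i j (t + 1) ^ 2 := by
        simp only [Finset.sum_add_distrib, ← Finset.mul_sum]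
    _ ≤ _ := by nlinarith [mul_le_mul_of_nonneg_left h1 hρ1, mul_le_mul_of_nonneg_left h2 hρ1]

variable (P) in
open Classical in
/-- The first-moment bound for ladders of solutions. -/
lemma measureReal_ladder_le {n T : ℕ} (hN : 0 < N) {β r p : ℝ}
    (hρ : ρ ∈ Set.Icc (0 : ℝ) 1) (hβ : β ∈ Set.Icc (0 : ℝ) (1 / 4)) (hκ : κ < 0)
    (hp : 1 - (((n + 1 : ℕ) : ℝ) * cdf (gaussianReal 0 1) κ - ((n + 1 : ℕ) : ℝ) ^ 2 *
      (2 * Real.exp (-(β * κ ^ 2 / 2)) * cdf (gaussianReal 0 1) κ)) ≤ p) (hp0 : 0 ≤ p) :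
    ((matrixNoise M N).prod P).real
      {q | ∃ (t : Fin (n + 1) → Fin (T + 1)) (σ : Fin (n + 1) → Fin N → ℤˣ), IsLinked r σ ∧
        (∀ k l, k < l → (t k : ℕ) ≤ t l ∧
          (β * N ≤ hammingDist (σ k) (σ l) ∨ ρ ^ ((t l : ℕ) - t k) ≤ 1 / 2)) ∧
        ∀ k, IsSolution κ (chainMatrix ρ (t k) q.1) (σ k)} ≤
    (T + 1 : ℝ) ^ (n + 1) * (Finset.univ.filter fun σ : Fin (n + 1) → Fin N → ℤˣ =>
      IsLinked r σ).card * p ^ M := by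
  set S := Finset.univ.filter fun σ : Fin (n + 1) → Fin N → ℤˣ => IsLinked r σ with hS
  let D : (Fin (n + 1) → Fin (T + 1)) × (Fin (n + 1) → Fin N → ℤˣ) →
      Set ((Fin M → Fin N → ℕ → ℝ) × Ω) := fun x =>
    {q | (∀ k l, k < l → (x.1 k : ℕ) ≤ x.1 l ∧
        (β * N ≤ hammingDist (x.2 k) (x.2 l) ∨ ρ ^ ((x.1 l : ℕ) - x.1 k) ≤ 1 / 2)) ∧
        ∀ k, IsSolution κ (chainMatrix ρ (x.1 k) q.1) (x.2 k)}
  have hD : ∀ x, ((matrixNoise M N).prod P).real (D x) ≤ p ^ M := by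
    intro x
    -- The separation conditions do not involve the randomness: if they fail for this tuple, its
    -- event is empty.
    by_cases hx : ∀ k l, k < l → (x.1 k : ℕ) ≤ x.1 l ∧
        (β * N ≤ hammingDist (x.2 k) (x.2 l) ∨ ρ ^ ((x.1 l : ℕ) - x.1 k) ≤ 1 / 2)
    · have h1 : D x = {z | ∀ k, IsSolution κ (chainMatrix ρ (x.1 k) z) (x.2 k)} ×ˢ Set.univ := by
        ext q
        simp only [D, Set.mem_ofPred_eq, Set.mem_prod, Set.mem_univ, and_true]
        exact ⟨fun h => h.2, fun h => ⟨hx, h⟩⟩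
      rw [h1, measureReal_prod_prod, probReal_univ, mul_one]
      exact matrixNoise_real_le hN hρ hβ hκ (fun k => x.1 k) x.2 hx hp
    · have h1 : D x = ∅ := by
        ext q
        simp only [D, Set.mem_ofPred_eq, Set.mem_empty_iff_false, iff_false]
        exact fun h => hx h.1
      rw [h1, measureReal_empty]
      positivity
  calc _ ≤ ((matrixNoise M N).prod P).real (⋃ x ∈ Finset.univ ×ˢ S, D x) := by
        refine measureReal_mono ?_ (measure_ne_top _ _)
        rintro q ⟨t, σ, h1, h2, h3⟩
        simp only [Set.mem_iUnion]
        refine ⟨(t, σ), ?_, h2, h3⟩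
        simp [hS, h1]
    _ ≤ ∑ x ∈ Finset.univ ×ˢ S, ((matrixNoise M N).prod P).real (D x) :=
        measureReal_biUnion_finset_le _ _
    _ ≤ (Finset.univ ×ˢ S : Finset ((Fin (n + 1) → Fin (T + 1)) × _)).card • p ^ M :=
        Finset.sum_le_card_nsmul _ _ _ fun x _ => hD x
    _ = _ := by
        rw [nsmul_eq_mul, Finset.card_product, Finset.card_univ]
        simp

open Classical in
/-- A stable algorithm makes at least one of the exceptional events of the ladder argument
likely. -/
lemma IsStableAt.one_le {n K : ℕ} {β p : ℝ} (h : IsStableAt P κ ρ pf pst (β / 2 * N) L A)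
    (hN : 0 < N) (hL : 0 ≤ L) (hρ : ρ ∈ Set.Icc (0 : ℝ) 1) (hβ : β ∈ Set.Icc (0 : ℝ) (1 / 4))
    (hκ : κ < 0) (hK : 0 < K) (hρK : ρ ^ K ≤ 1 / 2)
    (hstep : L ^ 2 * (6 * (1 - ρ) * (4 * (M * N))) ≤ (β / 2 * N) ^ 2)
    (hp : 1 - (((n + 1 : ℕ) : ℝ) * cdf (gaussianReal 0 1) κ - ((n + 1 : ℕ) : ℝ) ^ 2 *
      (2 * Real.exp (-(β * κ ^ 2 / 2)) * cdf (gaussianReal 0 1) κ)) ≤ p) (hp0 : 0 ≤ p) :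
    1 ≤ ((n * K : ℕ) + 1 : ℝ) * (pf + pst + 2 * (√2 / Real.exp 1) ^ (M * N)) +
      ((n * K : ℕ) + 1 : ℝ) ^ (n + 1) * (Finset.univ.filter fun σ : Fin (n + 1) → Fin N → ℤˣ =>
      IsLinked (2 * β * N) σ).card * p ^ M := by
  set T := n * K with hT
  set Q := (matrixNoise M N).prod P
  let B₁ : ℕ → Set ((Fin M → Fin N → ℕ → ℝ) × Ω) := fun t =>
    {q | ¬ IsSolution κ (chainMatrix ρ t q.1) (A (chainMatrix ρ t q.1) q.2)}
  let B₂ : ℕ → Set ((Fin M → Fin N → ℕ → ℝ) × Ω) := fun t =>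
    {q | ¬ (hammingDist (A (chainMatrix ρ t q.1) q.2) (A (chainMatrix ρ (t + 1) q.1) q.2) : ℝ) ≤
        β / 2 * N + L * frobNorm (chainMatrix ρ t q.1 - chainMatrix ρ (t + 1) q.1)}
  let B₃ : ℕ → Set ((Fin M → Fin N → ℕ → ℝ) × Ω) := fun t =>
    {q | 4 * (M * N : ℝ) < ∑ i, ∑ j, chainMatrix ρ t q.1 i j ^ 2}
  let B₄ : ℕ → Set ((Fin M → Fin N → ℕ → ℝ) × Ω) := fun t =>
    {q | 4 * (M * N : ℝ) < ∑ i, ∑ j, q.1 i j (t + 1) ^ 2}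
  let B₅ : Set ((Fin M → Fin N → ℕ → ℝ) × Ω) :=
    {q | ∃ (t : Fin (n + 1) → Fin (T + 1)) (σ : Fin (n + 1) → Fin N → ℤˣ),
        IsLinked (2 * β * N) σ ∧
        (∀ k l, k < l → (t k : ℕ) ≤ t l ∧
          (β * N ≤ hammingDist (σ k) (σ l) ∨ ρ ^ ((t l : ℕ) - t k) ≤ 1 / 2)) ∧
        ∀ k, IsSolution κ (chainMatrix ρ (t k) q.1) (σ k)}
  let U : ℕ → Set ((Fin M → Fin N → ℕ → ℝ) × Ω) := fun t => B₁ t ∪ B₂ t ∪ (B₃ t ∪ B₄ t)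
  have hU : ∀ t, Q.real (U t) ≤ pf + pst + 2 * (√2 / Real.exp 1) ^ (M * N) := by
    intro t
    have h1 : Q.real (U t) ≤ Q.real (B₁ t ∪ B₂ t) + Q.real (B₃ t ∪ B₄ t) :=
      measureReal_union_le _ _
    have h2 : Q.real (B₁ t ∪ B₂ t) ≤ Q.real (B₁ t) + Q.real (B₂ t) := measureReal_union_le _ _
    have h3 : Q.real (B₃ t ∪ B₄ t) ≤ Q.real (B₃ t) + Q.real (B₄ t) := measureReal_union_le _ _
    have h4 : Q.real (B₁ t) ≤ pf := h.failure_le hρ t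
    have h5 : Q.real (B₂ t) ≤ pst := h.instability_le hρ t
    have h6 : Q.real (B₃ t) ≤ (√2 / Real.exp 1) ^ (M * N) := chainMatrix_frobSq_tail P M N hρ t
    have h7 : Q.real (B₄ t) ≤ (√2 / Real.exp 1) ^ (M * N) := increment_frobSq_tail P M N t
    linarith
  -- Outside all the `U t` the outputs are solutions moving slowly, so they contain a ladder, which
  -- puts the point in `B₅`.
  have hcover : Set.univ ⊆ (⋃ t ∈ Finset.range (T + 1), U t) ∪ B₅ := by
    intro q _
    by_contra hq
    simp only [Set.mem_union, Set.mem_iUnion, not_or, not_exists, Finset.mem_range] at hq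
    obtain ⟨hq1, hq5⟩ := hq
    apply hq5
    have hgood : ∀ t < T + 1, q ∉ B₁ t ∧ q ∉ B₂ t ∧ q ∉ B₃ t ∧ q ∉ B₄ t := by
      intro t ht
      have := hq1 t ht
      simp only [U, Set.mem_union, not_or] at this
      exact ⟨this.1.1, this.1.2, this.2.1, this.2.2⟩
    -- Half of `βN` is the additive allowance `f`, the other half bounds `L` times the Frobenius
    -- increment.
    have hmove : ∀ t < T, (hammingDist (A (chainMatrix ρ t q.1) q.2)
        (A (chainMatrix ρ (t + 1) q.1) q.2) : ℝ) ≤ β * N := by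
      intro t ht
      obtain ⟨-, h2, h3, h4⟩ := hgood t (by omega)
      have h2' := not_not.1 h2
      have hF := frobNorm_chainMatrix_sub_le hρ t (not_lt.1 h3) (not_lt.1 h4)
      have hLF : L * √(6 * (1 - ρ) * (4 * (M * N))) ≤ β / 2 * N := by
        refine abs_le_of_sq_le_sq' ?_ (mul_nonneg (by linarith [hβ.1]) N.cast_nonneg) |>.2
        rw [mul_pow, Real.sq_sqrt (mul_nonneg (by linarith [hρ.2]) (by positivity))]
        exact hstep
      have := mul_le_mul_of_nonneg_left hF hL
      linarith
    obtain ⟨t, ht1, ht2, ht3⟩ := exists_ladder (mul_nonneg hβ.1 N.cast_nonneg) hK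
      (fun t => A (chainMatrix ρ t q.1) q.2) hmove n le_rfl
    have htT : ∀ k, t k < T + 1 := by
      intro k
      have h1 : (k : ℕ) * K ≤ n * K := Nat.mul_le_mul_right K (by omega)
      have := ht1 k
      omega
    refine ⟨fun k => ⟨t k, htT k⟩, fun k => A (chainMatrix ρ (t k) q.1) q.2, ?_, ?_, ?_⟩
    -- Separation radius plus step size, both equal to `βN`.
    · have : 2 * β * N = β * N + β * N := by ring
      rw [this]
      exact ht3
    · intro k l hkl
      obtain ⟨h1, h2⟩ := ht2 k l hkl
      refine ⟨h1, h2.imp id fun h3 => ?_⟩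
      exact (pow_le_pow_of_le_one hρ.1 hρ.2 h3).trans hρK
    · intro k
      exact not_not.1 (hgood (t k) (htT k)).1
  have h1 := measureReal_mono (μ := Q) hcover
  rw [probReal_univ] at h1
  have h2 := measureReal_union_le (μ := Q) (⋃ t ∈ Finset.range (T + 1), U t) B₅
  have h3 := (measureReal_biUnion_finset_le (μ := Q) (Finset.range (T + 1)) U).trans
    (Finset.sum_le_card_nsmul _ _ _ fun t _ => hU t)
  rw [Finset.card_range, nsmul_eq_mul] at h3
  have h4 : Q.real B₅ ≤ _ :=
    measureReal_ladder_le P (T := T) (r := 2 * β * N) hN hρ hβ hκ hp hp0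
  push_cast at h3 h4 ⊢
  linarith

end Events

/-! ### Choice of the parameters -/

open Classical in
/-- Numerical conditions at size `(M, N)` under which no algorithm is
`(ρ, pf, pst, β N / 2, L)`-stable: either solutions are missing too often, or the exceptional
events of the ladder argument have total probability below one. -/
def IsObstructed (κ ρ pf pst β L : ℝ) (M N : ℕ) : Prop :=
  pf < (gaussianMatrix M N).real {X | ∀ θ, ¬ IsSolution κ X θ} ∨
  ∃ (n K : ℕ) (p : ℝ), 0 < K ∧ 0 ≤ p ∧ ρ ^ K ≤ 1 / 2 ∧
    L ^ 2 * (6 * (1 - ρ) * (4 * (M * N))) ≤ (β / 2 * N) ^ 2 ∧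
    1 - (((n + 1 : ℕ) : ℝ) * cdf (gaussianReal 0 1) κ - ((n + 1 : ℕ) : ℝ) ^ 2 *
      (2 * Real.exp (-(β * κ ^ 2 / 2)) * cdf (gaussianReal 0 1) κ)) ≤ p ∧
    ((n * K : ℕ) + 1 : ℝ) * (pf + pst + 2 * (√2 / Real.exp 1) ^ (M * N)) +
      ((n * K : ℕ) + 1 : ℝ) ^ (n + 1) * (Finset.univ.filter fun σ : Fin (n + 1) → Fin N → ℤˣ =>
      IsLinked (2 * β * N) σ).card * p ^ M < 1

lemma IsObstructed.not_isStableAt {κ ρ pf pst β L : ℝ} {M N : ℕ}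
    (h : IsObstructed κ ρ pf pst β L M N) (hN : 0 < N) (hL : 0 ≤ L)
    (hρ : ρ ∈ Set.Icc (0 : ℝ) 1) (hβ : β ∈ Set.Icc (0 : ℝ) (1 / 4)) (hκ : κ < 0)
    {Ω : Type*} [MeasurableSpace Ω] (P : Measure Ω) [IsProbabilityMeasure P]
    (A : DataMatrix M N → Ω → (Fin N → ℤˣ)) :
    ¬ IsStableAt P κ ρ pf pst (β / 2 * N) L A := by
  intro hA
  rcases h with h | ⟨n, K, p, hK, hp0, hρK, hstep, hp, hlt⟩
  · exact absurd hA.no_solution_le (not_le.2 h)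
  · exact absurd (hA.one_le hN hL hρ hβ hκ hK hρK hstep hp hp0) (not_le.2 hlt)

lemma cdf_gaussianReal_pos (κ : ℝ) : 0 < cdf (gaussianReal 0 1) κ := by
  rw [← gaussianReal_one_real_Iio]
  exact ENNReal.toReal_pos (isOpen_Iio.measure_pos _ ⟨κ - 1, by simp⟩).ne' (measure_ne_top _ _)

/-- Chebyshev's inequality. This crude bound serves to force `α ≥ 3` from the hypothesis on `α`. -/
lemma sq_mul_cdf_gaussianReal_le {κ : ℝ} (hκ : κ < 0) :
    κ ^ 2 * cdf (gaussianReal 0 1) κ ≤ 1 := by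
  have h1 := meas_ge_le_variance_div_sq (memLp_id_gaussianReal (μ := 0) (v := 1) 2)
    (neg_pos.2 hκ)
  rw [variance_id_gaussianReal] at h1
  simp only [id, integral_id_gaussianReal, sub_zero, NNReal.coe_one] at h1
  have h2 : (gaussianReal 0 1).real (Set.Iio κ) ≤ 1 / (-κ) ^ 2 := by
    refine ENNReal.toReal_le_of_le_ofReal (div_nonneg zero_le_one (sq_nonneg _))
      ((measure_mono ?_).trans h1)
    intro x hx
    simp only [Set.mem_Iio, Set.mem_ofPred_eq] at hx ⊢
    rw [abs_of_neg (hx.trans hκ)]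
    linarith
  rw [gaussianReal_one_real_Iio, neg_sq, le_div_iff₀ (sq_pos_of_neg hκ)] at h2
  linarith

/-- The estimates relating the parameters of the ladder to the margin. -/
lemma ladder_estimates {κ α : ℝ} (hκ : κ < -100)
    (hα : 200 * Real.log |κ| ^ 2 / (κ ^ 2 * cdf (gaussianReal 0 1) κ) < α) :
    ∃ β : ℝ, 0 < β ∧ β ≤ 1 / 4 ∧ 3 ≤ α ∧ ∃ n : ℕ,
      1 - (((n + 1 : ℕ) : ℝ) * cdf (gaussianReal 0 1) κ - ((n + 1 : ℕ) : ℝ) ^ 2 *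
        (2 * Real.exp (-(β * κ ^ 2 / 2)) * cdf (gaussianReal 0 1) κ)) ≤
        Real.exp (-((n + 1 : ℕ) * cdf (gaussianReal 0 1) κ / 2)) ∧
      n * (2 * β * (1 - Real.log (2 * β))) + Real.log 2 -
        (n + 1 : ℕ) * cdf (gaussianReal 0 1) κ / 2 * (α / 2) ≤ -1 := by
  set Φ := cdf (gaussianReal 0 1) κ
  have hΦ : 0 < Φ := cdf_gaussianReal_pos κ
  have hΦ1 : κ ^ 2 * Φ ≤ 1 := sq_mul_cdf_gaussianReal_le (by linarith)
  rw [abs_of_neg (by linarith)] at hα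
  obtain ⟨x, rfl⟩ : ∃ x, κ = -x := ⟨-κ, by simp⟩
  rw [neg_neg, neg_sq] at hα
  rw [neg_sq] at hΦ1 ⊢
  have hx : 100 < x := by linarith
  have hx0 : 0 < x := by linarith
  have hx2 : 100 * x ≤ x ^ 2 := by nlinarith
  set ℓ := Real.log x with hℓ
  have hexp : Real.exp ℓ = x := Real.exp_log hx0
  have hℓ1 : 1 ≤ ℓ := by
    rw [hℓ, Real.le_log_iff_exp_le hx0]
    linarith [Real.exp_one_lt_d9]
  have hℓx : ℓ ≤ x := by linarith [Real.add_one_le_exp ℓ]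
  have hβ0 : 0 < 8 * ℓ / x ^ 2 := by positivity
  have hαΦ : 200 * ℓ ^ 2 < α * Φ * x ^ 2 := by
    rw [div_lt_iff₀ (by positivity)] at hα
    linarith
  have hα3 : 3 ≤ α := by
    by_contra h
    have h1 : 200 ≤ 200 * ℓ ^ 2 := by nlinarith
    have h2 : 0 < x ^ 2 * Φ := by positivity
    nlinarith
  -- With this `β` the pair factor `exp(-βκ²/2)` is `x⁻⁴`, which is negligible against `1/m` for `m
  -- ≈ x²`; and `m ≥ x²` is large enough to absorb the cost `log 2` of the first vector and the
  -- final `-1`.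
  refine ⟨8 * ℓ / x ^ 2, hβ0, ?_, hα3, ⌊x ^ 2⌋₊, ?_, ?_⟩
  · rw [div_le_iff₀ (by positivity)]
    nlinarith
  · set m : ℝ := ((⌊x ^ 2⌋₊ + 1 : ℕ) : ℝ) with hm
    have hm2 : m ≤ 2 * x ^ 2 := by
      have := Nat.floor_le (sq_nonneg x)
      push_cast at hm
      nlinarith
    have hm0 : 0 ≤ m := Nat.cast_nonneg _
    have he : Real.exp (-(8 * ℓ / x ^ 2 * x ^ 2 / 2)) = (x ^ 4)⁻¹ := by
      rw [div_mul_cancel₀ _ (by positivity), Real.exp_neg, ← hexp, ← Real.exp_nat_mul]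
      congr 2
      push_cast
      ring
    rw [he]
    have h1 : m * (2 * (x ^ 4)⁻¹) ≤ 1 / 2 := by
      rw [← div_eq_mul_inv, ← mul_div_assoc, div_le_iff₀ (by positivity)]
      nlinarith [sq_nonneg x, mul_nonneg (sq_nonneg x) (by nlinarith : 0 ≤ x ^ 2 - 8)]
    have h2 : m ^ 2 * (2 * (x ^ 4)⁻¹ * Φ) ≤ m * Φ / 2 := by
      have := mul_le_mul_of_nonneg_right h1 (mul_nonneg hm0 hΦ.le)
      nlinarith
    have h3 := Real.add_one_le_exp (-(m * Φ / 2))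
    linarith
  · set m : ℝ := ((⌊x ^ 2⌋₊ + 1 : ℕ) : ℝ) with hm
    have hmx : x ^ 2 ≤ m := by
      rw [hm]
      push_cast
      exact (Nat.lt_floor_add_one _).le
    have hnm : ((⌊x ^ 2⌋₊ : ℕ) : ℝ) ≤ m := by rw [hm]; push_cast; linarith
    have hb : 2 * (8 * ℓ / x ^ 2) = 16 * ℓ / x ^ 2 := by ring
    have hlog : -(2 * ℓ) ≤ Real.log (16 * ℓ / x ^ 2) := by
      rw [Real.log_div (by positivity) (by positivity), Real.log_pow]
      have : 0 ≤ Real.log (16 * ℓ) := Real.log_nonneg (by linarith)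
      push_cast
      linarith
    -- Here `1 - log(2β) ≤ 1 + 2ℓ ≤ 3ℓ`, so the entropy per vector is at most `48ℓ²/x²`; the
    -- constant 200 provides `50ℓ²/x²`.
    have hh : 2 * (8 * ℓ / x ^ 2) * (1 - Real.log (2 * (8 * ℓ / x ^ 2))) ≤
        48 * ℓ ^ 2 / x ^ 2 := by
      rw [hb]
      calc _ ≤ 16 * ℓ / x ^ 2 * (3 * ℓ) :=
            mul_le_mul_of_nonneg_left (by linarith) (by positivity)
        _ = _ := by ring
    have h1 : ((⌊x ^ 2⌋₊ : ℕ) : ℝ) * (2 * (8 * ℓ / x ^ 2) *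
        (1 - Real.log (2 * (8 * ℓ / x ^ 2)))) ≤ m * (48 * ℓ ^ 2 / x ^ 2) :=
      (mul_le_mul_of_nonneg_left hh (Nat.cast_nonneg _)).trans
        (mul_le_mul_of_nonneg_right hnm (by positivity))
    have h2 : 50 * ℓ ^ 2 / x ^ 2 ≤ α * Φ / 4 := by
      rw [div_le_iff₀ (by positivity)]
      linarith
    have h3 : m * (50 * ℓ ^ 2 / x ^ 2) ≤ m * (α * Φ / 4) :=
      mul_le_mul_of_nonneg_left h2 (Nat.cast_nonneg _)
    have h4 : 2 ≤ m * (2 * ℓ ^ 2 / x ^ 2) := by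
      rw [← mul_div_assoc, le_div_iff₀ (by positivity)]
      have : 1 ≤ ℓ ^ 2 := one_le_pow₀ hℓ1
      have := mul_le_mul hmx this zero_le_one (Nat.cast_nonneg _)
      linarith
    have h5 : m * (50 * ℓ ^ 2 / x ^ 2) = m * (48 * ℓ ^ 2 / x ^ 2) + m * (2 * ℓ ^ 2 / x ^ 2) := by
      ring
    have h6 := Real.log_two_lt_d9
    linarith

open Classical in
-- Entropy and row probabilities combine into one exponent, at most `-1` per coordinate; the
-- remaining prefactor is free of `N` once `T` is fixed.
lemma first_moment_le {n T N M : ℕ} {β Φ α : ℝ} (hβ0 : 0 < β) (hβ : β ≤ 1 / 4) (hΦ : 0 ≤ Φ)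
    (hM : α / 2 * N ≤ M)
    (hexp : n * (2 * β * (1 - Real.log (2 * β))) + Real.log 2 -
        (n + 1 : ℕ) * Φ / 2 * (α / 2) ≤ -1) :
    (T + 1 : ℝ) ^ (n + 1) * (Finset.univ.filter fun σ : Fin (n + 1) → Fin N → ℤˣ =>
      IsLinked (2 * β * N) σ).card * Real.exp (-((n + 1 : ℕ) * Φ / 2)) ^ M ≤
    (T + 1 : ℝ) ^ (n + 1) * (n + 1 : ℝ) ^ n * Real.exp (-1) ^ N := by
  set h := 2 * β * (1 - Real.log (2 * β))
  have hcard : ((Finset.univ.filter fun σ : Fin (n + 1) → Fin N → ℤˣ =>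
      IsLinked (2 * β * N) σ).card : ℝ) ≤ (n + 1 : ℝ) ^ n * Real.exp (N * (n * h + Real.log 2)) := by
    have h1 := card_isLinked_le (N := N) (m := n + 1) (V := ⌊Real.exp (N * h)⌋₊) (r := 2 * β * N)
      (fun σ => Nat.le_floor (card_hammingBall_le σ (by linarith) (by linarith))) n le_rfl
    have h2 : ((⌊Real.exp (N * h)⌋₊ : ℕ) : ℝ) ≤ Real.exp (N * h) :=
      Nat.floor_le (Real.exp_pos _).le
    calc _ ≤ ((((n + 1) * ⌊Real.exp (N * h)⌋₊) ^ n * 2 ^ N : ℕ) : ℝ) := by exact_mod_cast h1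
      _ = (n + 1 : ℝ) ^ n * ((⌊Real.exp (N * h)⌋₊ : ℝ) ^ n * 2 ^ N) := by
        push_cast
        rw [mul_pow, mul_assoc]
      _ ≤ (n + 1 : ℝ) ^ n * (Real.exp (N * h) ^ n * 2 ^ N) := by gcongr
      _ = _ := by
        congr 1
        rw [mul_add, Real.exp_add, Real.exp_nat_mul (Real.log 2), Real.exp_log two_pos,
          ← Real.exp_nat_mul (N * h) n, mul_left_comm]
  have hpM : Real.exp (-((n + 1 : ℕ) * Φ / 2)) ^ M ≤
      Real.exp (-(N * ((n + 1 : ℕ) * Φ / 2 * (α / 2)))) := by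
    rw [← Real.exp_nat_mul, Real.exp_le_exp]
    have := mul_le_mul_of_nonneg_right hM (by positivity : 0 ≤ ((n + 1 : ℕ) : ℝ) * Φ / 2)
    nlinarith
  calc _ ≤ (T + 1 : ℝ) ^ (n + 1) * ((n + 1 : ℝ) ^ n * Real.exp (N * (n * h + Real.log 2))) *
        Real.exp (-(N * ((n + 1 : ℕ) * Φ / 2 * (α / 2)))) := by gcongr
    _ = (T + 1 : ℝ) ^ (n + 1) * (n + 1 : ℝ) ^ n * Real.exp (N * (n * h + Real.log 2 -
        (n + 1 : ℕ) * Φ / 2 * (α / 2))) := by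
        rw [mul_sub, sub_eq_add_neg, Real.exp_add]
        ring
    _ ≤ _ := by
        rw [← Real.exp_nat_mul]
        gcongr

lemma exists_isObstructed {κ α L : ℝ} (hκ : κ < -100)
    (hα : 200 * Real.log |κ| ^ 2 / (κ ^ 2 * cdf (gaussianReal 0 1) κ) < α) (hL : 0 < L) :
    ∃ ρ ∈ Set.Ioo (0 : ℝ) 1, ∃ pf ∈ Set.Ioo (0 : ℝ) 1, ∃ pst ∈ Set.Ioo (0 : ℝ) 1,
      ∃ β ∈ Set.Ioc (0 : ℝ) (1 / 4), ∀ N : ℕ, 0 < N → ∀ M : ℕ, |(M : ℝ) / N - α| ≤ 1 →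
        IsObstructed κ ρ pf pst β L M N := by
  obtain ⟨β, hβ0, hβ, hα3, n, hp, hexp⟩ := ladder_estimates hκ hα
  set Φ := cdf (gaussianReal 0 1) κ
  have hΦ : 0 ≤ Φ := cdf_nonneg _ _
  -- `η = 1 - ρ`, small enough that `24 L² η (α+1) ≤ β²/4`, the step condition with `M ≤ (α+1)N`.
  set η := min (1 / 2) (β ^ 2 / (96 * L ^ 2 * (α + 1))) with hη
  have hα1 : 0 < α + 1 := by linarith
  have hη0 : 0 < η := lt_min (by norm_num) (by positivity)
  have hη1 : η ≤ 1 / 2 := min_le_left _ _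
  have hη2 : η * (96 * L ^ 2 * (α + 1)) ≤ β ^ 2 := by
    rw [← le_div_iff₀ (by positivity)]
    exact min_le_right _ _
  obtain ⟨K, hK⟩ := exists_pow_lt_of_lt_one (by norm_num : (0 : ℝ) < 1 / 2)
    (by linarith : 1 - η < 1)
  have hK0 : 0 < K := by
    rcases Nat.eq_zero_or_pos K with h | h
    · rw [h] at hK; norm_num at hK
    · exact h
  set T := n * K with hT
  set q := √2 / Real.exp 1 with hq
  have hq0 : 0 ≤ q := by positivity
  have hq1 : q < 1 := by
    rw [hq, div_lt_one (Real.exp_pos _)]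
    have h1 : √2 < 2 := by rw [Real.sqrt_lt' two_pos]; norm_num
    linarith [Real.exp_one_gt_d9]
  have hlim : Tendsto (fun N : ℕ => ((T : ℝ) + 1) * (2 * q ^ N) +
      (T + 1 : ℝ) ^ (n + 1) * (n + 1 : ℝ) ^ n * Real.exp (-1) ^ N) atTop (𝓝 0) := by
    have h1 := tendsto_pow_atTop_nhds_zero_of_lt_one hq0 hq1
    have h2 := tendsto_pow_atTop_nhds_zero_of_lt_one (Real.exp_pos (-1)).le
      (by rw [Real.exp_lt_one_iff]; norm_num)
    simpa using ((h1.const_mul 2).const_mul ((T : ℝ) + 1)).add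
      (h2.const_mul ((T + 1 : ℝ) ^ (n + 1) * (n + 1 : ℝ) ^ n))
  obtain ⟨N₁, hN₁⟩ := eventually_atTop.1
    (hlim.eventually (gt_mem_nhds (by norm_num : (0 : ℝ) < 1 / 2)))
  obtain ⟨p₁, hp₁, hsmall⟩ := exists_lt_no_solution_prob κ ⌈(α + 1) * N₁⌉₊ N₁
  -- Over `T + 1` times `pf` and `pst` then contribute at most `1/4`, and the terms vanishing in `N`
  -- less than `1/2`.
  set s : ℝ := 1 / (8 * (T + 1)) with hs
  have hT1 : (1 : ℝ) ≤ T + 1 := by linarith [(Nat.cast_nonneg T : (0 : ℝ) ≤ T)]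
  have hs0 : 0 < s := by positivity
  have hsT : (T + 1 : ℝ) * s = 1 / 8 := by rw [hs]; field_simp
  have hs1 : s < 1 := by nlinarith
  refine ⟨1 - η, ⟨by linarith, by linarith⟩, min s p₁,
    ⟨lt_min hs0 hp₁, (min_le_left _ _).trans_lt hs1⟩, s, ⟨hs0, hs1⟩, β, ⟨hβ0, hβ⟩, fun N hN M hM => ?_⟩
  have hN' : (0 : ℝ) < N := by exact_mod_cast hN
  have hN1 : (1 : ℝ) ≤ N := by exact_mod_cast hN
  rw [abs_le] at hM
  have hMlow : (α - 1) * N ≤ M := by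
    rw [← le_div_iff₀ hN']; linarith
  have hMup : (M : ℝ) ≤ (α + 1) * N := by
    rw [← div_le_iff₀ hN']; linarith
  have hM2 : 2 ≤ M := by
    have : (2 : ℝ) ≤ M := by nlinarith
    exact_mod_cast this
  -- Small sizes are excluded by unsatisfiability, large ones by the ladder.
  rcases le_or_gt N N₁ with hle | hgt
  · left
    refine (min_le_right _ _).trans_lt (hsmall M N hM2 ?_ hN hle)
    have hle' : (N : ℝ) ≤ N₁ := by exact_mod_cast hle
    have h1 : (M : ℝ) ≤ (⌈(α + 1) * N₁⌉₊ : ℕ) :=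
      (hMup.trans (mul_le_mul_of_nonneg_left hle' hα1.le)).trans (Nat.le_ceil _)
    exact_mod_cast h1
  · right
    refine ⟨n, K, _, hK0, (Real.exp_pos _).le, hK.le, ?_, hp, ?_⟩
    · have h1 : (M : ℝ) * N ≤ (α + 1) * N * N := mul_le_mul_of_nonneg_right hMup hN'.le
      have h2 : 24 * L ^ 2 * η * (M * N) ≤ 24 * L ^ 2 * η * ((α + 1) * N * N) :=
        mul_le_mul_of_nonneg_left h1 (by positivity)
      have h3 := mul_le_mul_of_nonneg_right hη2 (sq_nonneg (N : ℝ))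
      nlinarith
    · have h1 := first_moment_le (n := n) (T := T) (N := N) (M := M) hβ0 hβ hΦ
        (by nlinarith : α / 2 * N ≤ M) hexp
      have h2 := hN₁ N hgt.le
      have h3 : q ^ (M * N) ≤ q ^ N :=
        pow_le_pow_of_le_one hq0 hq1.le (Nat.le_mul_of_pos_left N (by omega))
      have h4 : (T + 1 : ℝ) * (min s p₁ + s + 2 * q ^ (M * N)) ≤
          (T + 1 : ℝ) * (s + s + 2 * q ^ N) :=
        mul_le_mul_of_nonneg_left (by linarith [min_le_left s p₁]) (by linarith)
      linarith

end BinaryPerceptron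

end

/-! ### The theorem -/

theorem mainTheorem7 :
    ∃ C₁ > (0 : ℝ), ∃ κ₁ < (0 : ℝ), ∃ N₀ : ℕ, ∀ κ < κ₁, ∀ α : ℝ,
      C₁ * Real.log |κ| ^ 2 / (κ ^ 2 * cdf (gaussianReal 0 1) κ) < α →
      ∀ L > (0 : ℝ),
      ∃ ρ ∈ Set.Ioo (0 : ℝ) 1, ∃ pf ∈ Set.Ioo (0 : ℝ) 1, ∃ pst ∈ Set.Ioo (0 : ℝ) 1,
      ∃ C > (0 : ℝ),
        (∀ M : ℕ → ℕ, Tendsto (fun N => (M N : ℝ) / N) atTop (𝓝 α) →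
          ∀ (Ω : Type*) [MeasurableSpace Ω] (P : Measure Ω) [IsProbabilityMeasure P]
            (A : ∀ N, DataMatrix (M N) N → Ω → (Fin N → ℤˣ)),
            ¬ IsStable P M κ ρ pf pst (fun N => C * N) L A) ∧
        (∃ δ > (0 : ℝ), ∀ N > N₀, ∀ M : ℕ, |(M : ℝ) / N - α| ≤ δ →
          ∀ (Ω : Type*) [MeasurableSpace Ω] (P : Measure Ω) [IsProbabilityMeasure P]
            (A : DataMatrix M N → Ω → (Fin N → ℤˣ)),
            ¬ IsStableAt P κ ρ pf pst (C * N) L A) := by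
  refine ⟨200, by norm_num, -100, by norm_num, 0, fun κ hκ α hα L hL => ?_⟩
  obtain ⟨ρ, hρ, pf, hpf, pst, hpst, β, hβ, hobs⟩ := exists_isObstructed hκ hα hL
  have hρ' : ρ ∈ Set.Icc (0 : ℝ) 1 := ⟨hρ.1.le, hρ.2.le⟩
  have hβ' : β ∈ Set.Icc (0 : ℝ) (1 / 4) := ⟨hβ.1.le, hβ.2⟩
  have hκ0 : κ < 0 := by linarith
  -- The first claim needs just one size with `|M N / N - α| ≤ 1` at which the algorithm is stable.
  refine ⟨ρ, hρ, pf, hpf, pst, hpst, β / 2, half_pos hβ.1, ?_, 1, one_pos, ?_⟩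
  · intro M hM Ω _ P _ A hA
    have hclose : ∀ᶠ N in atTop, |(M N : ℝ) / N - α| ≤ 1 := by
      filter_upwards [hM.eventually (Metric.closedBall_mem_nhds α one_pos)] with N hN
      simpa [Real.dist_eq] using hN
    obtain ⟨N, ⟨hAN, hN⟩, hN0⟩ := ((hA.and hclose).and (eventually_gt_atTop 0)).exists
    exact (hobs N hN0 (M N) hN).not_isStableAt hN0 hL.le hρ' hβ' hκ0 P (A N) hAN
  · intro N hN M hM Ω _ P _ A
    exact (hobs N hN M hM).not_isStableAt hN hL.le hρ' hβ' hκ0 P A
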